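/- For $d\in[0,\infty]$ and $k\ge 0$ put $\theta_d(k)=2\arctan(k/d)$ if $0<d<\infty$, $\theta_0(k)=\pi$ and $\theta_\infty(k)=0$. For $L>0$, $\vartheta_0,\vartheta_L\in[0,\infty]$ and $j\ge1$ let $\lambda_j\ge 0$ be the solution of $2L\lambda_j+\theta_{\vartheta_0}(\lambda_j)+\theta_{\vartheta_L}(\lambda_j)=2\pi j$. Let $\varphi_j(x)=\cos(\lambda_jx)+\vartheta_0\frac{\sin(\lambda_jx)}{\lambda_j}$ if $\vartheta_0<\infty$ (with $\frac{\sin(\lambda_j x)}{\lambda_j}=x$ if $\lambda_j=0$), and $\varphi_j(x)=\sin(\lambda_jx)$ if $\vartheta_0=\infty$. The ground state wave function of $N$ impenetrable bosons in the box $[0,L]$ is $$\psi_{N,L}(x_1,\dots,x_N|\vartheta_0,\vartheta_L)=\frac1{\sqrt{V}}\Bigl|\det_{1\le j,k\le N}\varphi_j(x_k)\Bigr|,\qquad V=\int_{[0,L]^N}\Bigl(\det_{1\le j,k\le N}\varphi_j(y_k)\Bigr)^2dy,$$ and its correlation functions (density matrices) are $$\rho_{n,N,L}(x'|x''|\vartheta_0,\vartheta_L)=\frac{(n+N)!}{N!}\int_{[0,L]^N}\psi_{n+N,L}(x'_1,\dots,x'_n,y_1,\dots,y_N|\vartheta_0,\vartheta_L)\,\psi_{n+N,L}(x''_1,\dots,x''_n,y_1,\dots,y_N|\vartheta_0,\vartheta_L)\,dy.$$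 Write $\rho_{n,N,L}(x'|x''|+)$ for $\vartheta_0=\vartheta_L=0$ (Neumann boundary conditions, $\lambda_j=(j-1)\pi/L$) and $\rho_{n,N,L}(x'|x''|-)$ for $\vartheta_0=\vartheta_L=\infty$ (Dirichlet boundary conditions, $\lambda_j=j\pi/L$). **Corollary.** Let $\rho_0>0$, $\varepsilon=\pm$, $n\ge 0$, and $x'_1,\dots,x'_n,x''_1,\dots,x''_n\in[0,\infty)$. Let $x_1\le\dots\le x_{2n}$ be the increasing re-ordering of these $2n$ numbers and $I_p=[x_1,x_2]\cup\dots\cup[x_{2n-1},x_{2n}]$. Let $\hat K_{\varepsilon,I_p}$ be the integral operator on $I_p$ with the kernel $$K_\varepsilon(x,y)=\frac{\sin\rho_0\pi(x-y)}{x-y}+\varepsilon\,\frac{\sin\rho_0\pi(x+y)}{x+y}$$ (where $\frac{\sin\rho_0\pi t}{t}=\rho_0\pi$ at $t=0$). Then the series for the $n$-th Fredholm minor $$\det\Bigl(1-\lambda\hat K_{\varepsilon,I_p}\Bigm|{x'_1,\dots,x'_n\atop x''_1,\dots,x''_n}\Bigr)=\sum_{l=0}^\infty\frac{(-\lambda)^{l+n}}{l!}\int_{I_p^l}\det_{1\le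 i,j\le n+l}\bigl(K_\varepsilon(u_i,v_j)\bigr)\,dz_1\cdots dz_l,$$ $$(u_1,\dots,u_{n+l})=(x'_1,\dots,x'_n,z_1,\dots,z_l),\qquad(v_1,\dots,v_{n+l})=(x''_1,\dots,x''_n,z_1,\dots,z_l),$$ has integrable terms and converges absolutely at $\lambda=2/\pi$, and, as $N,L\to\infty$ with $N/L=\rho_0$ fixed, the correlation functions converge, with limit $$\lim_{\substack{N,L\to\infty\\ N/L=\rho_0}}\rho_{n,N,L}(x'|x''|\varepsilon)=\Bigl(-\frac12\Bigr)^n\prod_{1\le j<k\le n}\mathrm{sgn}(x'_k-x'_j)\,\mathrm{sgn}(x''_k-x''_j)\;\det\Bigl(1-\frac2\pi\hat K_{\varepsilon,I_p}\Bigm|{x'_1,\dots,x'_n\atop x''_1,\dots,x''_n}\Bigr),$$ where $\mathrm{sgn}(0)=0$. -/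

import Mathlib

namespace BoseGas

open Filter Topology MeasureTheory

/-- The phase `θ_d(k) = i log ((i d + k) / (i d - k)) = 2 arctan (k / d)` on the branch
`-π < θ_d < π`, for `0 < d < ∞`, `k ≥ 0`. The values at `d = 0` and `d = ∞` are the limits
`d → 0+` and `d → ∞` (for `k > 0`). -/
noncomputable def phase (d : ENNReal) (k : ℝ) : ℝ :=
  if d = ⊤ then 0 else if d = 0 then Real.pi else 2 * Real.arctan (k / d.toReal)

/-- The `j`-th momentum (`j ≥ 1`): the unique solution `k ≥ 0` of
`2 L k + θ_{ϑ₀}(k) + θ_{ϑ_L}(k) = 2 π j`. -/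
noncomputable def momentum (L : ℝ) (ϑ₀ ϑL : ENNReal) (j : ℕ) : ℝ :=
  sInf {k : ℝ | 0 ≤ k ∧ 2 * L * k + phase ϑ₀ k + phase ϑL k = 2 * Real.pi * j}

/-- The one-particle wave function with momentum `k`, up to a positive constant factor:
for `ϑ₀ < ∞` it is `(k cos (k x) + ϑ₀ sin (k x)) / k`, continued to `k = 0`, and for
`ϑ₀ = ∞` it is `sin (k x)`. The constant factor drops out of the normalised wave function. -/
noncomputable def orbital (ϑ₀ : ENNReal) (k x : ℝ) : ℝ :=
  if ϑ₀ = ⊤ then Real.sin (k * x)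
  else Real.cos (k * x) + ϑ₀.toReal * (x * Real.sinc (k * x))

/-- The box `[0, L]^N`. -/
def box (N : ℕ) (L : ℝ) : Set (Fin N → ℝ) :=
  Set.univ.pi fun _ => Set.Icc 0 L

/-- The determinant of the orbitals with the momenta `λ₁ < ⋯ < λ_N` at the points `x`. -/
noncomputable def orbitalDet (N : ℕ) (L : ℝ) (ϑ₀ ϑL : ENNReal) (x : Fin N → ℝ) : ℝ :=
  (Matrix.of fun j k : Fin N => orbital ϑ₀ (momentum L ϑ₀ ϑL ((j : ℕ) + 1)) (x k)).det

/-- The normalisation factor, which makes the integral of `ψ²` over the box equal to one. -/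
noncomputable def normalization (N : ℕ) (L : ℝ) (ϑ₀ ϑL : ENNReal) : ℝ :=
  ∫ y in box N L, orbitalDet N L ϑ₀ ϑL y ^ 2

/-- The ground state wave function `ψ_{N,L}` of `N` impenetrable bosons in `[0, L]`. -/
noncomputable def waveFunction (N : ℕ) (L : ℝ) (ϑ₀ ϑL : ENNReal) (x : Fin N → ℝ) : ℝ :=
  1 / Real.sqrt (normalization N L ϑ₀ ϑL) * |orbitalDet N L ϑ₀ ϑL x|

/-- The correlation function (density matrix) `ρ_{n,N,L}(x' | x'' | ϑ₀, ϑ_L)`, computed in the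
ground state of `n + N` particles. -/
noncomputable def densityMatrix (n N : ℕ) (L : ℝ) (ϑ₀ ϑL : ENNReal) (x' x'' : Fin n → ℝ) : ℝ :=
  ((n + N).factorial : ℝ) / (N.factorial : ℝ) *
    ∫ y in box N L, waveFunction (n + N) L ϑ₀ ϑL (Fin.append x' y) *
      waveFunction (n + N) L ϑ₀ ϑL (Fin.append x'' y)

/-- The two boundary conditions: Neumann (`ε = +`) and Dirichlet (`ε = -`). -/
inductive Boundary where
  | neumann
  | dirichlet

/-- The sign `ε`. -/
def Boundary.sign : Boundary → ℝ
  | .neumann => 1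
  | .dirichlet => -1

/-- The common value of `ϑ₀` and `ϑ_L`. -/
def Boundary.param : Boundary → ENNReal
  | .neumann => 0
  | .dirichlet => ⊤

/-- The correlation function `ρ_{n,N,L}(x' | x'' | ε)`. -/
noncomputable def correlation (n N : ℕ) (L : ℝ) (ε : Boundary) (x' x'' : Fin n → ℝ) : ℝ :=
  densityMatrix n N L ε.param ε.param x' x''

/-- `N, L → ∞` with `N / L = ρ₀`. -/
def thermodynamicLimit (ρ₀ : ℝ) : Filter (ℕ × ℝ) :=
  (atTop ×ˢ atTop) ⊓ 𝓟 {p : ℕ × ℝ | (p.1 : ℝ) / p.2 = ρ₀}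

/-- The increasing re-ordering `x_1 ≤ ⋯ ≤ x_{2n}` of `x'_1, …, x'_n, x''_1, …, x''_n`. -/
noncomputable def sortedPoints {n : ℕ} (x' x'' : Fin n → ℝ) : Fin (n + n) → ℝ :=
  Fin.append x' x'' ∘ Tuple.sort (Fin.append x' x'')

/-- `I_p = [x_1, x_2] ∪ ⋯ ∪ [x_{2n-1}, x_{2n}]`. -/
def intervalUnion {n : ℕ} (x' x'' : Fin n → ℝ) : Set ℝ :=
  ⋃ j : Fin n, Set.Icc (sortedPoints x' x'' ⟨2 * (j : ℕ), by omega⟩)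
    (sortedPoints x' x'' ⟨2 * (j : ℕ) + 1, by omega⟩)

/-- The kernel `sin (ρ₀ π (x - y)) / (x - y) + ε sin (ρ₀ π (x + y)) / (x + y)`, where
`sin (a t) / t` has its continuous value `a` at `t = 0`. -/
noncomputable def limitKernel (ρ₀ : ℝ) (ε : Boundary) (x y : ℝ) : ℝ :=
  ρ₀ * Real.pi * Real.sinc (ρ₀ * Real.pi * (x - y)) +
    ε.sign * (ρ₀ * Real.pi * Real.sinc (ρ₀ * Real.pi * (x + y)))

/-- `K (x'_1, …, x'_n, z_1, …, z_l ; x''_1, …, x''_n, z_1, …, z_l)`, the determinant of the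
values of the kernel. -/
noncomputable def kernelDet (K : ℝ → ℝ → ℝ) {n l : ℕ} (x' x'' : Fin n → ℝ) (z : Fin l → ℝ) : ℝ :=
  (Matrix.of fun i j : Fin (n + l) => K (Fin.append x' z i) (Fin.append x'' z j)).det

/-- The `l`-th term of the series of the `n`-th Fredholm minor of `1 - c K̂` on `J`. -/
noncomputable def fredholmMinorTerm (K : ℝ → ℝ → ℝ) (J : Set ℝ) (c : ℝ) {n : ℕ}
    (x' x'' : Fin n → ℝ) (l : ℕ) : ℝ :=
  (-c) ^ (l + n) / (l.factorial : ℝ) *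
    ∫ z in Set.univ.pi (fun _ : Fin l => J), kernelDet K x' x'' z

/-- The `n`-th Fredholm minor of `1 - c K̂`, where `(K̂ f)(x) = ∫_J K(x, y) f(y) dy`. -/
noncomputable def fredholmMinor (K : ℝ → ℝ → ℝ) (J : Set ℝ) (c : ℝ) {n : ℕ}
    (x' x'' : Fin n → ℝ) : ℝ :=
  ∑' l : ℕ, fredholmMinorTerm K J c x' x'' l

/-- `∏_{j < k} sgn (x'_k - x'_j) sgn (x''_k - x''_j)`. -/
noncomputable def signFactor {n : ℕ} (x' x'' : Fin n → ℝ) : ℝ :=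
  ∏ j : Fin n, ∏ k ∈ Finset.Ioi j, Real.sign (x' k - x' j) * Real.sign (x'' k - x'' j)

end BoseGas

/-! For both boundary conditions the orbitals are, up to a common factor that is nonnegative on the
box, polynomials of increasing degree in cos(πx/L). The orbital determinant is therefore a
Vandermonde product, and since cosine decreases on [0, π] its absolute value is the determinant
times a constant sign times ∏ sgn(x_k - x_j). In a product of two wave functions sharing the
variables y, the signs among the y's cancel, the signs among the x' and the x'' give the prefactor,
and the mixed signs give one factor 1 - 2·1_{I_p}(y_k) for each integrated variable
(`abs_det_mode_mul_abs_det_mode`).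

The product of the two determinants is, after normalisation, a determinant of the kernel K of the
projection onto the n + N lowest modes. Integrating one free variable out of such a determinant
lowers its size and leaves a numerical factor. So expanding ∏(1 + h(y_k)) with h = -2·1_{I_p} gives
a finite Fredholm-type sum over l ≤ N (`integral_kernelDet_mul_prod_one_add`, `correlation_eq_sum`).

In the thermodynamic limit K is a difference or sum of Dirichlet kernels and tends pointwise to
K_ε/π (`tendsto_modeKernel`). Hadamard's inequality bounds the l-th term uniformly by a summable
sequence (`summable_hadamard`), so dominated convergence applies to each integral and then to the
sum over l. -/

namespace BoseGas

open Filter Topology MeasureTheory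

/-! ### Determinants of kernels: Hadamard bound and bordered expansion -/

section Determinants

open Matrix

/-- Hadamard's inequality for a real matrix with bounded entries. -/
theorem abs_det_le_of_abs_le {m : ℕ} (A : Matrix (Fin m) (Fin m) ℝ) {C : ℝ} (hC : 0 ≤ C)
    (hA : ∀ i j, |A i j| ≤ C) : |A.det| ≤ (Real.sqrt m * C) ^ m := by
  have : Fact (Module.finrank ℝ (EuclideanSpace ℝ (Fin m)) = m) := ⟨by simp⟩
  let b := EuclideanSpace.basisFun (Fin m) ℝ
  -- The volume form of an orthonormal basis is the determinant, and it is bounded by the product of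
  -- the norms of the rows.
  have h := Orientation.abs_volumeForm_apply_le b.toBasis.orientation
    (fun i => WithLp.toLp 2 (A i))
  rw [Orientation.volumeForm_robust _ b rfl, Module.Basis.det_apply] at h
  have hdet : (b.toBasis.toMatrix fun i => WithLp.toLp 2 (A i)) = A.transpose := by
    ext i j
    simp [Module.Basis.toMatrix_apply, b]
  rw [hdet, det_transpose] at h
  refine h.trans ?_
  have hrow : ∀ i, ‖(WithLp.toLp 2 (A i) : EuclideanSpace ℝ (Fin m))‖ ≤ Real.sqrt m * C := by
    intro i
    rw [EuclideanSpace.norm_eq, ← Real.sqrt_sq hC, ← Real.sqrt_mul (Nat.cast_nonneg m)]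
    refine Real.sqrt_le_sqrt ?_
    calc ∑ j, ‖A i j‖ ^ 2 ≤ ∑ _j : Fin m, C ^ 2 := by
          refine Finset.sum_le_sum fun j _ => ?_
          exact pow_le_pow_left₀ (norm_nonneg _) (hA i j) 2
      _ = m * C ^ 2 := by simp
  calc ∏ i, ‖(WithLp.toLp 2 (A i) : EuclideanSpace ℝ (Fin m))‖
      ≤ ∏ _i : Fin m, (Real.sqrt m * C) :=
        Finset.prod_le_prod (fun _ _ => norm_nonneg _) fun i _ => hrow i
    _ = _ := by simp

/-- The expansion of a bordered determinant. -/
theorem det_bordered {k : ℕ} (A : Matrix (Fin (k + 1)) (Fin (k + 1)) ℝ) :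
    A.det = A 0 0 * (A.submatrix Fin.succ Fin.succ).det -
      ∑ j : Fin k, ∑ i : Fin k, A 0 j.succ * A i.succ 0 *
        (A.submatrix Fin.succ Fin.succ).adjugate j i := by
  rw [det_succ_row_zero, Fin.sum_univ_succ]
  cases k with
  | zero => simp
  | succ k =>
    rw [sub_eq_add_neg, ← Finset.sum_neg_distrib]
    congr 1
    · simp [Fin.succAbove_zero]
    · refine Finset.sum_congr rfl fun j _ => ?_
      rw [det_succ_column_zero, Finset.mul_sum, ← Finset.sum_neg_distrib]
      refine Finset.sum_congr rfl fun i _ => ?_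
      rw [adjugate_fin_succ_eq_det_submatrix]
      have hsub : ((A.submatrix Fin.succ j.succ.succAbove).submatrix i.succAbove Fin.succ) =
          ((A.submatrix Fin.succ Fin.succ).submatrix i.succAbove j.succAbove) := by
        ext a b
        simp
      rw [hsub]
      simp only [submatrix_apply, Fin.val_succ, Fin.succ_succAbove_zero]
      ring

/-- The determinant with a pair of points inserted at the same place does not depend on the
place. -/
theorem det_kernel_insertNth (K : ℝ → ℝ → ℝ) {k : ℕ} (p : Fin (k + 1)) (t : ℝ)
    (u v : Fin k → ℝ) :
    (of fun i j : Fin (k + 1) => K (p.insertNth (α := fun _ => ℝ) t u i)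
      (p.insertNth (α := fun _ => ℝ) t v j)).det =
    (of fun i j : Fin (k + 1) => K (Fin.cons (α := fun _ => ℝ) t u i)
      (Fin.cons (α := fun _ => ℝ) t v j)).det := by
  -- The same reindexing acts on rows and columns, so no sign appears.
  let σ : Fin (k + 1) ≃ Fin (k + 1) := (finSuccEquiv' 0).trans (finSuccEquiv' p).symm
  rw [← det_submatrix_equiv_self σ]
  have hσ : ∀ (w : Fin k → ℝ) (i : Fin (k + 1)),
      p.insertNth (α := fun _ => ℝ) t w (σ i) = Fin.cons (α := fun _ => ℝ) t w i := by
    intro w i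
    cases i using Fin.cases with
    | zero => simp [σ]
    | succ i =>
      have : finSuccEquiv' (0 : Fin (k + 1)) i.succ = some i := by
        rw [← Fin.succAbove_zero, finSuccEquiv'_succAbove]
      simp [σ, this]
  congr 1
  ext i j
  simp [hσ]

/-- Lets `det_kernel_insertNth` act on an integration variable, which sits behind the n fixed
points. -/
theorem append_insertNth {n m : ℕ} (x : Fin n → ℝ) (y : Fin m → ℝ) (i : Fin (m + 1)) (t : ℝ) :
    Fin.append x (i.insertNth (α := fun _ => ℝ) t y) =
      (Fin.natAdd n i : Fin (n + m + 1)).insertNth (α := fun _ => ℝ) t (Fin.append x y) := by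
  rw [Fin.eq_insertNth_iff]
  constructor
  · exact (Fin.append_right x _ i).trans (by simp)
  · ext j
    simp only [Fin.removeNth]
    cases j using Fin.addCases with
    | left j =>
      have h : (Fin.natAdd n i : Fin (n + m + 1)).succAbove (Fin.castAdd m j) =
          (Fin.castAdd (m + 1) j : Fin (n + (m + 1))) := by
        rw [Fin.succAbove_of_castSucc_lt]
        · rfl
        · simp [Fin.lt_def]; omega
      rw [h, Fin.append_left, Fin.append_left]
    | right j =>
      have h : (Fin.natAdd n i : Fin (n + m + 1)).succAbove (Fin.natAdd n j) =
          (Fin.natAdd n (i.succAbove j) : Fin (n + (m + 1))) := by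
        apply Fin.ext
        by_cases hji : j.castSucc < i
        · rw [Fin.succAbove_of_castSucc_lt, Fin.val_natAdd, Fin.succAbove_of_castSucc_lt _ _ hji]
          · simp
          · simp [Fin.lt_def] at hji ⊢; omega
        · rw [not_lt] at hji
          rw [Fin.succAbove_of_le_castSucc, Fin.val_natAdd, Fin.succAbove_of_le_castSucc _ _ hji]
          · simp; omega
          · simp [Fin.le_def] at hji ⊢; omega
      rw [h, Fin.append_right, Fin.append_right, Fin.insertNth_apply_succAbove]

theorem abs_kernelDet_le {K : ℝ → ℝ → ℝ} {C : ℝ} (hC : 0 ≤ C) {n l : ℕ} {x' x'' : Fin n → ℝ}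
    {z : Fin l → ℝ} {S : Set ℝ} (hK : ∀ x ∈ S, ∀ y ∈ S, |K x y| ≤ C) (hx' : ∀ i, x' i ∈ S)
    (hx'' : ∀ i, x'' i ∈ S) (hz : ∀ i, z i ∈ S) :
    |kernelDet K x' x'' z| ≤ (Real.sqrt (n + l) * C) ^ (n + l) := by
  have happ : ∀ w : Fin n → ℝ, (∀ i, w i ∈ S) → ∀ i, Fin.append w z i ∈ S := by
    intro w hw i
    cases i using Fin.addCases with
    | left i => simpa using hw i
    | right i => simpa using hz i
  have h := abs_det_le_of_abs_le
    (of fun i j : Fin (n + l) => K (Fin.append x' z i) (Fin.append x'' z j)) hC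
    fun i j => hK _ (happ x' hx' i) _ (happ x'' hx'' j)
  rwa [Nat.cast_add] at h

theorem measurable_append {n l : ℕ} (x : Fin n → ℝ) (i : Fin (n + l)) :
    Measurable fun z : Fin l → ℝ => Fin.append x z i := by
  cases i using Fin.addCases with
  | left i => simp
  | right i => simpa using measurable_pi_apply i

theorem measurable_kernelDet {K : ℝ → ℝ → ℝ} (hK : Measurable (Function.uncurry K)) {n l : ℕ}
    (x' x'' : Fin n → ℝ) : Measurable fun z : Fin l → ℝ => kernelDet K x' x'' z := by
  simp only [kernelDet, det_apply, of_apply]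
  refine Finset.measurable_sum _ fun σ _ => Measurable.const_smul ?_ _
  refine Finset.measurable_prod _ fun i _ => ?_
  exact hK.comp ((measurable_append x' _).prodMk (measurable_append x'' _))

end Determinants

/-! ### Integrals of determinants of a projection kernel -/

section ProjectionKernel

open Matrix

variable {μ : Measure ℝ} [IsFiniteMeasure μ] {K : ℝ → ℝ → ℝ} {C R : ℝ}

/-- Integrating out one variable of the determinant of a projection kernel of trace `R`. -/
theorem integral_det_kernel_cons (hK : Measurable (Function.uncurry K))
    (hC : ∀ x y, |K x y| ≤ C) (hrep : ∀ x y, ∫ t, K x t * K t y ∂μ = K x y)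
    (htr : ∫ t, K t t ∂μ = R) {k : ℕ} (u v : Fin k → ℝ) :
    ∫ t, (of fun i j : Fin (k + 1) => K (Fin.cons (α := fun _ => ℝ) t u i)
      (Fin.cons (α := fun _ => ℝ) t v j)).det ∂μ =
    (R - k) * (of fun i j : Fin k => K (u i) (v j)).det := by
  set P : Matrix (Fin k) (Fin k) ℝ := of fun i j => K (u i) (v j) with hP
  have hexp : ∀ t, (of fun i j : Fin (k + 1) => K (Fin.cons (α := fun _ => ℝ) t u i)
      (Fin.cons (α := fun _ => ℝ) t v j)).det =
      K t t * P.det - ∑ j : Fin k, ∑ i : Fin k, (K (u i) t * K t (v j)) * P.adjugate j i := by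
    intro t
    rw [det_bordered]
    have : ((of fun i j : Fin (k + 1) => K (Fin.cons (α := fun _ => ℝ) t u i)
      (Fin.cons (α := fun _ => ℝ) t v j)).submatrix Fin.succ Fin.succ) = P := by
      ext i j; simp [hP]
    rw [this]
    simp only [of_apply, Fin.cons_zero, Fin.cons_succ]
    congr 1
    exact Finset.sum_congr rfl fun j _ => Finset.sum_congr rfl fun i _ => by ring
  -- Diagonal entries of adj(P) P = det(P). After the reproducing property each j contributes one
  -- det(P), hence the total -k det(P) beside R det(P).
  have hj' : ∀ j, ∑ i, P.adjugate j i * P i j = P.det := by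
    intro j
    have h := congrFun (congrFun (adjugate_mul P) j) j
    rw [mul_apply] at h
    simpa using h
  -- The cofactors do not depend on t; as opaque constants they are untouched when P is unfolded
  -- below.
  obtain ⟨c, hc⟩ : ∃ c : Fin k → Fin k → ℝ, ∀ j i, c j i = P.adjugate j i := ⟨_, fun _ _ => rfl⟩
  simp only [← hc] at hexp hj'
  have hC0 : 0 ≤ C := (abs_nonneg _).trans (hC 0 0)
  have hint1 : Integrable (fun t => K t t) μ :=
    Integrable.of_bound (hK.comp (measurable_id.prodMk measurable_id)).aestronglyMeasurable C
      (ae_of_all _ fun t => hC t t)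
  have hint2 : ∀ x y, Integrable (fun t => K x t * K t y) μ := fun x y =>
    Integrable.of_bound
      ((hK.comp (measurable_const.prodMk measurable_id)).mul
        (hK.comp (measurable_id.prodMk measurable_const))).aestronglyMeasurable (C * C)
      (ae_of_all _ fun t => by
        rw [Real.norm_eq_abs, abs_mul]
        exact mul_le_mul (hC _ _) (hC _ _) (abs_nonneg _) hC0)
  simp_rw [hexp]
  rw [integral_sub (hint1.mul_const _)
    (integrable_finsetSum _ fun j _ => integrable_finsetSum _ fun i _ => (hint2 _ _).mul_const _),
    integral_mul_const, htr, integral_finsetSum _ fun j _ =>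
      integrable_finsetSum _ fun i _ => (hint2 _ _).mul_const _]
  have hj : ∀ j : Fin k, ∫ t, ∑ i : Fin k, (K (u i) t * K t (v j)) * c j i ∂μ =
      P.det := by
    intro j
    rw [integral_finsetSum _ fun i _ => (hint2 _ _).mul_const _]
    rw [← hj' j]
    refine Finset.sum_congr rfl fun i _ => ?_
    rw [integral_mul_const, hrep, mul_comm, hP, of_apply]
  simp only [hj, Finset.sum_const, Finset.card_univ, Fintype.card_fin, nsmul_eq_mul]
  ring

/-- The integral of a determinant against `a` factors `h` followed by factors `1 + h`. -/
noncomputable def mixedIntegral (μ : Measure ℝ) (K : ℝ → ℝ → ℝ) {n : ℕ} (x' x'' : Fin n → ℝ)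
    (h : ℝ → ℝ) (m a : ℕ) : ℝ :=
  ∫ y : Fin m → ℝ, kernelDet K x' x'' y *
    ∏ k : Fin m, (if (k : ℕ) < a then h (y k) else 1 + h (y k)) ∂(Measure.pi fun _ => μ)

theorem integrable_kernelDet_mul_prod (hK : Measurable (Function.uncurry K))
    (hC : ∀ x y, |K x y| ≤ C) {n : ℕ} (x' x'' : Fin n → ℝ) {m : ℕ} {w : Fin m → ℝ → ℝ} {B : ℝ}
    (hw : ∀ k, Measurable (w k)) (hB : ∀ k t, |w k t| ≤ B) :
    Integrable (fun y : Fin m → ℝ => kernelDet K x' x'' y * ∏ k, w k (y k))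
      (Measure.pi fun _ => μ) := by
  have hC0 : 0 ≤ C := (abs_nonneg _).trans (hC 0 0)
  refine Integrable.of_bound ((measurable_kernelDet hK x' x'').mul
    (Finset.measurable_prod _ fun k _ => (hw k).comp (measurable_pi_apply k))).aestronglyMeasurable
    ((Real.sqrt (n + m) * C) ^ (n + m) * B ^ m) (ae_of_all _ fun y => ?_)
  rw [Real.norm_eq_abs, abs_mul, Finset.abs_prod]
  refine mul_le_mul (abs_kernelDet_le (S := Set.univ) hC0 (fun x _ y _ => hC x y)
    (fun _ => trivial) (fun _ => trivial) (fun _ => trivial)) ?_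
    (Finset.prod_nonneg fun _ _ => abs_nonneg _) (by positivity)
  calc ∏ k, |w k (y k)| ≤ ∏ _k : Fin m, B :=
        Finset.prod_le_prod (fun _ _ => abs_nonneg _) fun k _ => hB k _
    _ = B ^ m := by simp

/-- The two integrands of size m + 1 differ only in the factor at position a, where (1 + h) - h = 1.
The variable there carries no weight in the difference and is integrated out by
`integral_det_kernel_cons`, applied to a determinant of size n + m + 1. -/
theorem mixedIntegral_succ (hK : Measurable (Function.uncurry K))
    (hC : ∀ x y, |K x y| ≤ C) (hrep : ∀ x y, ∫ t, K x t * K t y ∂μ = K x y)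
    (htr : ∫ t, K t t ∂μ = R) {n : ℕ} (x' x'' : Fin n → ℝ) {h : ℝ → ℝ} {B : ℝ}
    (hh : Measurable h) (hB : ∀ t, |h t| ≤ B) {m a : ℕ} (ham : a ≤ m) :
    mixedIntegral μ K x' x'' h (m + 1) a =
      mixedIntegral μ K x' x'' h (m + 1) (a + 1) +
        (R - (n + m)) * mixedIntegral μ K x' x'' h m a := by
  have hB' : ∀ t, |1 + h t| ≤ 1 + B := fun t =>
    (abs_add_le _ _).trans (by rw [abs_one]; linarith [hB t])
  set p : Fin (m + 1) := ⟨a, Nat.lt_succ_of_le ham⟩ with hp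
  have hval : ∀ k : Fin m, ((p.succAbove k : ℕ) < a ↔ (k : ℕ) < a) ∧
      ((p.succAbove k : ℕ) < a + 1 ↔ (k : ℕ) < a) := by
    intro k
    by_cases hk : (k : ℕ) < a
    · rw [Fin.succAbove_of_castSucc_lt _ _ (by simpa [Fin.lt_def, hp] using hk)]
      simp; omega
    · rw [Fin.succAbove_of_le_castSucc _ _ (by simpa [Fin.le_def, hp] using hk)]
      simp; omega
  have hmeas : ∀ (b : ℕ) {m : ℕ} (k : Fin m),
      Measurable fun t => if (k : ℕ) < b then h t else 1 + h t := by
    intro b m k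
    split_ifs
    · exact hh
    · exact hh.const_add 1
  have hbd : ∀ (b : ℕ) {m : ℕ} (k : Fin m) (t : ℝ),
      |if (k : ℕ) < b then h t else 1 + h t| ≤ 1 + B := by
    intro b m k t
    split_ifs
    · linarith [hB t]
    · exact hB' t
  have hint : ∀ b m, Integrable (fun y : Fin m → ℝ => kernelDet K x' x'' y *
      ∏ k : Fin m, (if (k : ℕ) < b then h (y k) else 1 + h (y k))) (Measure.pi fun _ => μ) :=
    fun b m => integrable_kernelDet_mul_prod hK hC x' x'' (hmeas b) (hbd b)
  rw [← sub_eq_iff_eq_add', mixedIntegral, mixedIntegral, ← integral_sub (hint _ _) (hint _ _),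
    mixedIntegral, ← integral_const_mul]
  set W : (Fin m → ℝ) → ℝ := fun y => ∏ k : Fin m, (if (k : ℕ) < a then h (y k) else 1 + h (y k))
    with hW
  have hdiff : ∀ y : Fin (m + 1) → ℝ,
      kernelDet K x' x'' y * ∏ k : Fin (m + 1), (if (k : ℕ) < a then h (y k) else 1 + h (y k)) -
      kernelDet K x' x'' y *
        ∏ k : Fin (m + 1), (if (k : ℕ) < a + 1 then h (y k) else 1 + h (y k)) =
      kernelDet K x' x'' y * W (fun k => y (p.succAbove k)) := by
    intro y
    rw [Fin.prod_univ_succAbove _ p, Fin.prod_univ_succAbove _ p]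
    simp only [(hval _).1, (hval _).2, hW]
    simp only [hp, lt_irrefl, if_false, Nat.lt_succ_self, if_true]
    ring
  have hfun := funext hdiff
  have hint' := (hint a (m + 1)).sub (hint (a + 1) (m + 1))
  have hint'' : Integrable (fun y : Fin (m + 1) → ℝ =>
      kernelDet K x' x'' y * W (fun k => y (p.succAbove k))) (Measure.pi fun _ => μ) := by
    rw [← hfun]; exact hint'
  rw [hfun]
  have hmp := (measurePreserving_piFinSuccAbove (fun _ : Fin (m + 1) => μ) p).symm
  rw [← hmp.integral_comp', integral_prod_symm]
  · refine integral_congr_ae (ae_of_all _ fun y => ?_)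
    have heval : ∀ t : ℝ, kernelDet K x' x''
        ((MeasurableEquiv.piFinSuccAbove (fun _ : Fin (m + 1) => ℝ) p).symm (t, y)) =
        (of fun i j : Fin (n + m + 1) => K (Fin.cons (α := fun _ => ℝ) t (Fin.append x' y) i)
          (Fin.cons (α := fun _ => ℝ) t (Fin.append x'' y) j)).det := by
      intro t
      have h := det_kernel_insertNth K (Fin.natAdd n p : Fin (n + m + 1)) t
        (Fin.append x' y) (Fin.append x'' y)
      rw [← append_insertNth, ← append_insertNth] at h
      exact h
    have hWe : ∀ t : ℝ, W (fun k => (MeasurableEquiv.piFinSuccAbove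
        (fun _ : Fin (m + 1) => ℝ) p).symm (t, y) (p.succAbove k)) = W y := by
      intro t
      congr 1
      ext k
      exact Fin.insertNth_apply_succAbove (α := fun _ => ℝ) p t y k
    simp only [heval, hWe]
    rw [integral_mul_const, integral_det_kernel_cons hK hC hrep htr]
    simp only [Nat.cast_add, kernelDet]
    ring
  · exact (hmp.integrable_comp_emb (MeasurableEquiv.measurableEmbedding _)).2 hint''

/-- Trading one of the b remaining factors 1 + h for h or for 1 is Pascal's rule, so iterating down
to b = 0 produces binomial coefficients. -/
theorem pascal_expansion (F : ℕ → ℕ → ℝ) (N : ℕ)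
    (hF : ∀ b a, a + b < N → F (b + 1) a = F b (a + 1) + F b a) :
    ∀ b a, a + b ≤ N → F b a = ∑ i ∈ Finset.range (b + 1), (b.choose i : ℝ) * F 0 (a + i) := by
  intro b
  induction b with
  | zero => intro a _; simp
  | succ b ih =>
    intro a hab
    rw [hF b a (by omega), ih (a + 1) (by omega), ih a (by omega), Finset.sum_range_succ' _ (b + 1)]
    simp only [Nat.choose_succ_succ, Nat.cast_add, add_mul, Finset.sum_add_distrib]
    have hlast : ∑ i ∈ Finset.range (b + 1), (b.choose i : ℝ) * F 0 (a + i) =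
        ∑ i ∈ Finset.range (b + 1), (b.choose (i + 1) : ℝ) * F 0 (a + (i + 1)) + F 0 a := by
      rw [Finset.sum_range_succ', Finset.sum_range_succ _ b]
      simp
    have hshift : ∀ i, a + 1 + i = a + (i + 1) := fun i => by ring
    rw [hlast]
    simp only [hshift, Nat.choose_zero_right, Nat.cast_one, one_mul, add_zero]
    ring

theorem integral_kernelDet_mul_prod_one_add (hK : Measurable (Function.uncurry K))
    (hC : ∀ x y, |K x y| ≤ C) (hrep : ∀ x y, ∫ t, K x t * K t y ∂μ = K x y) {n N : ℕ}
    (htr : ∫ t, K t t ∂μ = (n + N : ℕ)) (x' x'' : Fin n → ℝ) {h : ℝ → ℝ} {B : ℝ}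
    (hh : Measurable h) (hB : ∀ t, |h t| ≤ B) :
    ∫ y : Fin N → ℝ, kernelDet K x' x'' y * ∏ k, (1 + h (y k)) ∂(Measure.pi fun _ => μ) =
      ∑ l ∈ Finset.range (N + 1), (N.factorial : ℝ) / l.factorial *
        ∫ y : Fin l → ℝ, kernelDet K x' x'' y * ∏ k, h (y k) ∂(Measure.pi fun _ => μ) := by
  -- With trace n + N the factor in `mixedIntegral_succ` is N - m for m = a + b. The weight (N - m)!
  -- absorbs it and leaves the pure Pascal recurrence.
  have key := pascal_expansion
    (fun b a => ((N - (a + b)).factorial : ℝ) * mixedIntegral μ K x' x'' h (a + b) a) N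
    (by
      intro b a hab
      have h1 := mixedIntegral_succ hK hC hrep htr x' x'' hh hB (m := a + b) (a := a) (by omega)
      have e1 : a + (b + 1) = a + b + 1 := by ring
      have e2 : a + 1 + b = a + b + 1 := by ring
      have e3 : N - (a + b) = N - (a + b + 1) + 1 := by omega
      have e4 : ((n + N : ℕ) : ℝ) - (n + (a + b : ℕ)) = ((N - (a + b + 1) : ℕ) : ℝ) + 1 := by
        rw [Nat.cast_sub (by omega)]; push_cast; ring
      simp only [e1, e2]
      rw [e3, Nat.factorial_succ, h1, e4]
      push_cast
      ring) N 0 (by omega)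
  simp only [zero_add, Nat.sub_self, Nat.factorial_zero, Nat.cast_one, one_mul, add_zero] at key
  have hl : mixedIntegral μ K x' x'' h N 0 =
      ∫ y : Fin N → ℝ, kernelDet K x' x'' y * ∏ k, (1 + h (y k)) ∂(Measure.pi fun _ => μ) := by
    simp [mixedIntegral]
  rw [← hl, key]
  refine Finset.sum_congr rfl fun l hlN => ?_
  have hlN' : l ≤ N := by simpa [Nat.lt_succ_iff] using hlN
  have hr : mixedIntegral μ K x' x'' h l l =
      ∫ y : Fin l → ℝ, kernelDet K x' x'' y * ∏ k, h (y k) ∂(Measure.pi fun _ => μ) := by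
    simp [mixedIntegral]
  rw [hr, ← mul_assoc, Nat.cast_choose ℝ hlN']
  congr 1
  have := Nat.factorial_ne_zero (N - l)
  field_simp

end ProjectionKernel

/-! ### Momenta and orbitals for Neumann and Dirichlet conditions -/

section Momenta

/-- Each phase at ϑ = 0 is π for every k, including k = 0, so the momentum equation is linear and
the first momentum is 0. -/
theorem momentum_neumann {L : ℝ} (hL : 0 < L) (j : ℕ) :
    momentum L 0 0 (j + 1) = j * Real.pi / L := by
  have h : {k : ℝ | 0 ≤ k ∧ 2 * L * k + phase 0 k + phase 0 k = 2 * Real.pi * ((j + 1 : ℕ) : ℝ)} =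
      {j * Real.pi / L} := by
    ext k
    simp only [phase, ENNReal.zero_ne_top, if_false, if_true, Set.mem_ofPred_eq,
      Set.mem_singleton_iff, eq_div_iff hL.ne']
    push_cast
    constructor
    · rintro ⟨_, h⟩
      linarith
    · intro h
      refine ⟨?_, by linarith⟩
      have : 0 ≤ k * L := by rw [h]; positivity
      exact nonneg_of_mul_nonneg_left this hL
  rw [momentum, h, csInf_singleton]

theorem momentum_dirichlet {L : ℝ} (hL : 0 < L) (j : ℕ) :
    momentum L ⊤ ⊤ (j + 1) = (j + 1) * Real.pi / L := by
  have h : {k : ℝ | 0 ≤ k ∧ 2 * L * k + phase ⊤ k + phase ⊤ k = 2 * Real.pi * ((j + 1 : ℕ) : ℝ)} =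
      {(j + 1) * Real.pi / L} := by
    ext k
    simp only [phase, if_true, Set.mem_ofPred_eq, Set.mem_singleton_iff, eq_div_iff hL.ne']
    push_cast
    constructor
    · rintro ⟨_, h⟩
      linarith
    · intro h
      refine ⟨?_, by linarith⟩
      have : 0 ≤ k * L := by rw [h]; positivity
      exact nonneg_of_mul_nonneg_left this hL
  rw [momentum, h, csInf_singleton]

/-- The one-particle wave functions for the two boundary conditions. -/
noncomputable def mode (ε : Boundary) (L : ℝ) (j : ℕ) (x : ℝ) : ℝ :=
  match ε with
  | .neumann => Real.cos (j * (Real.pi * x / L))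
  | .dirichlet => Real.sin ((j + 1) * (Real.pi * x / L))

theorem orbital_momentum {L : ℝ} (hL : 0 < L) (ε : Boundary) (j : ℕ) (x : ℝ) :
    orbital ε.param (momentum L ε.param ε.param (j + 1)) x = mode ε L j x := by
  cases ε with
  | neumann =>
    simp only [Boundary.param, momentum_neumann hL, orbital, ENNReal.zero_ne_top, if_false, mode,
      ENNReal.toReal_zero, zero_mul, add_zero]
    congr 1
    ring
  | dirichlet =>
    simp only [Boundary.param, momentum_dirichlet hL, orbital, if_true, mode]
    congr 1
    ring

theorem orbitalDet_eq {L : ℝ} (hL : 0 < L) (ε : Boundary) (N : ℕ) (x : Fin N → ℝ) :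
    orbitalDet N L ε.param ε.param x =
      (Matrix.of fun j k : Fin N => mode ε L j (x k)).det := by
  simp only [orbitalDet, orbital_momentum hL]

end Momenta

/-! ### Sign of the orbital determinant via Chebyshev polynomials -/

section Chebyshev

open Matrix Polynomial

/-- The matrix is a Vandermonde matrix times the coefficient matrix, which is triangular with the
leading coefficients on its diagonal. -/
theorem det_eval_eq_prod_leadingCoeff_mul {N : ℕ} (p : Fin N → ℝ[X])
    (hp : ∀ j, (p j).natDegree = j) (v : Fin N → ℝ) :
    (of fun j k : Fin N => (p j).eval (v k)).det =
      (∏ j, (p j).leadingCoeff) * ∏ j, ∏ k ∈ Finset.Ioi j, (v k - v j) := by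
  rw [← det_transpose]
  have h := eval_matrixOfPolynomials_eq_vandermonde_mul_matrixOfPolynomials v p
    fun i => (hp i).le
  have ht : (of fun j k : Fin N => (p j).eval (v k)).transpose =
      of fun i j => (p j).eval (v i) := rfl
  rw [ht, h, det_mul, det_vandermonde, mul_comm]
  congr 1
  rw [det_of_isUpperTriangular]
  · refine Finset.prod_congr rfl fun j _ => ?_
    simp [Polynomial.leadingCoeff, hp]
  · intro i j hij
    exact Polynomial.coeff_eq_zero_of_natDegree_lt (by rw [hp]; exact hij)

/-- cos(jθ) = T_j(cos θ) and sin((j+1)θ) = sin θ · U_j(cos θ) with θ = πx/L. The leading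
coefficients of T_j and U_j are positive, and sin θ ≥ 0 on the box. -/
theorem exists_det_mode_eq {L : ℝ} (hL : 0 < L) (ε : Boundary) (N : ℕ) :
    ∃ c : ℝ, 0 < c ∧ ∃ s : ℝ → ℝ, (∀ x ∈ Set.Icc 0 L, 0 ≤ s x) ∧ ∀ x : Fin N → ℝ,
      (of fun j k : Fin N => mode ε L j (x k)).det =
        c * (∏ k, s (x k)) * ∏ j, ∏ k ∈ Finset.Ioi j,
          (Real.cos (Real.pi * x k / L) - Real.cos (Real.pi * x j / L)) := by
  cases ε with
  | neumann =>
    refine ⟨∏ j : Fin N, (Chebyshev.T ℝ (j : ℕ)).leadingCoeff, ?_, fun _ => 1,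
      fun _ _ => zero_le_one, fun x => ?_⟩
    · refine Finset.prod_pos fun j _ => ?_
      rw [Chebyshev.leadingCoeff_T]
      positivity
    · rw [Finset.prod_const_one, mul_one, ← det_eval_eq_prod_leadingCoeff_mul
        (fun j : Fin N => Chebyshev.T ℝ (j : ℕ)) (fun j => by simp [Chebyshev.natDegree_T])
        fun k => Real.cos (Real.pi * x k / L)]
      simp [mode, Chebyshev.T_real_cos]
  | dirichlet =>
    refine ⟨∏ j : Fin N, (Chebyshev.U ℝ (j : ℕ)).leadingCoeff, ?_,
      fun x => Real.sin (Real.pi * x / L), fun x hx => ?_, fun x => ?_⟩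
    · refine Finset.prod_pos fun j _ => ?_
      rw [Chebyshev.leadingCoeff_U_natCast]
      positivity
    · refine Real.sin_nonneg_of_nonneg_of_le_pi ?_ ?_
      · exact div_nonneg (mul_nonneg Real.pi_pos.le hx.1) hL.le
      · rw [div_le_iff₀ hL]
        exact mul_le_mul_of_nonneg_left hx.2 Real.pi_pos.le
    · rw [mul_right_comm, ← det_eval_eq_prod_leadingCoeff_mul
        (fun j : Fin N => Chebyshev.U ℝ (j : ℕ)) (fun j => by simp [Chebyshev.natDegree_U_natCast])
        fun k => Real.cos (Real.pi * x k / L), mul_comm, ← det_mul_row]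
      congr 1
      ext j k
      simp only [of_apply, mode]
      rw [mul_comm (Real.sin _), Chebyshev.U_real_cos]
      simp

/-- `∏_{j < k} sgn (z_k - z_j)`. -/
noncomputable def orderSign {m : ℕ} (z : Fin m → ℝ) : ℝ :=
  ∏ j : Fin m, ∏ k ∈ Finset.Ioi j, Real.sign (z k - z j)

theorem abs_cos_sub_cos {a b : ℝ} (ha : a ∈ Set.Icc 0 Real.pi) (hb : b ∈ Set.Icc 0 Real.pi) :
    |Real.cos b - Real.cos a| = -1 * (Real.cos b - Real.cos a) * Real.sign (b - a) := by
  rcases lt_trichotomy a b with h | h | h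
  · have := Real.strictAntiOn_cos ha hb h
    rw [Real.sign_of_pos (sub_pos.2 h), abs_of_neg (sub_neg.2 this)]
    ring
  · simp [h]
  · have := Real.strictAntiOn_cos hb ha h
    rw [Real.sign_of_neg (sub_neg.2 h), abs_of_pos (sub_pos.2 this)]
    ring

theorem sign_mul_of_pos {c : ℝ} (hc : 0 < c) (t : ℝ) : Real.sign (c * t) = Real.sign t := by
  rcases lt_trichotomy t 0 with h | h | h
  · rw [Real.sign_of_neg h, Real.sign_of_neg (mul_neg_of_pos_of_neg hc h)]
  · simp [h]
  · rw [Real.sign_of_pos h, Real.sign_of_pos (mul_pos hc h)]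

/-- Only the Vandermonde factor can change sign. Since cosine decreases, each pair contributes
-sgn(x_k - x_j); at coinciding points both sides vanish. -/
theorem abs_det_mode {L : ℝ} (hL : 0 < L) (ε : Boundary) {N : ℕ} {x : Fin N → ℝ}
    (hx : ∀ k, x k ∈ Set.Icc 0 L) :
    |(of fun j k : Fin N => mode ε L j (x k)).det| =
      (∏ j : Fin N, ∏ _k ∈ Finset.Ioi j, (-1)) * (of fun j k : Fin N => mode ε L j (x k)).det *
        orderSign x := by
  obtain ⟨c, hc, s, hs, h⟩ := exists_det_mode_eq hL ε N
  rw [h, abs_mul, abs_mul, abs_of_pos hc, Finset.abs_prod, orderSign]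
  have hs' : ∏ k, |s (x k)| = ∏ k, s (x k) :=
    Finset.prod_congr rfl fun k _ => abs_of_nonneg (hs _ (hx k))
  have hang : ∀ k, Real.pi * x k / L ∈ Set.Icc 0 Real.pi := fun k =>
    ⟨div_nonneg (mul_nonneg Real.pi_pos.le (hx k).1) hL.le, by
      rw [div_le_iff₀ hL]; exact mul_le_mul_of_nonneg_left (hx k).2 Real.pi_pos.le⟩
  have hp : |∏ j, ∏ k ∈ Finset.Ioi j,
      (Real.cos (Real.pi * x k / L) - Real.cos (Real.pi * x j / L))| =
      ∏ j, ∏ k ∈ Finset.Ioi j, (-1 * (Real.cos (Real.pi * x k / L) -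
        Real.cos (Real.pi * x j / L)) * Real.sign (x k - x j)) := by
    rw [Finset.abs_prod]
    refine Finset.prod_congr rfl fun j _ => ?_
    rw [Finset.abs_prod]
    refine Finset.prod_congr rfl fun k _ => ?_
    rw [abs_cos_sub_cos (hang j) (hang k)]
    congr 1
    rw [← sign_mul_of_pos (div_pos Real.pi_pos hL) (x k - x j)]
    congr 1
    ring
  rw [hs', hp]
  simp only [Finset.prod_mul_distrib]
  ring

end Chebyshev

/-! ### Cancellation of signs and the weight 1 - 2·1_{I_p} -/

section OrderSign

theorem orderSign_eq {m : ℕ} (z : Fin m → ℝ) :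
    orderSign z = ∏ j : Fin m, ∏ k : Fin m, if j < k then Real.sign (z k - z j) else 1 := by
  refine Finset.prod_congr rfl fun j _ => ?_
  rw [← Finset.prod_filter]
  congr 1
  ext k
  simp

theorem orderSign_append {n m : ℕ} (x : Fin n → ℝ) (y : Fin m → ℝ) :
    orderSign (Fin.append x y) =
      orderSign x * orderSign y * ∏ k, ∏ i, Real.sign (y k - x i) := by
  simp only [orderSign_eq, Fin.prod_univ_add, Fin.append_left, Fin.append_right]
  have h1 : ∀ (i : Fin n) (k : Fin m), Fin.castAdd m i < Fin.natAdd n k := by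
    intro i k; rw [Fin.lt_def, Fin.val_castAdd, Fin.val_natAdd]; omega
  have h2 : ∀ (i : Fin n) (k : Fin m), ¬ Fin.natAdd n k < Fin.castAdd m i := by
    intro i k; rw [Fin.lt_def, Fin.val_castAdd, Fin.val_natAdd]; omega
  have h3 : ∀ i k : Fin n, Fin.castAdd m i < Fin.castAdd m k ↔ i < k := by
    intro i k; rw [Fin.lt_def, Fin.val_castAdd, Fin.val_castAdd, Fin.lt_def]
  have h4 : ∀ i k : Fin m, Fin.natAdd n i < Fin.natAdd n k ↔ i < k := by
    intro i k; rw [Fin.lt_def, Fin.val_natAdd, Fin.val_natAdd, Fin.lt_def]; omega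
  simp only [h1, h2, h3, h4, if_true, if_false, Finset.prod_const_one, one_mul,
    Finset.prod_mul_distrib]
  rw [Finset.prod_comm (f := fun k i => Real.sign (y k - x i))]
  ring

theorem sign_mul_self_of_ne_zero {t : ℝ} (ht : t ≠ 0) : Real.sign t * Real.sign t = 1 := by
  rcases lt_or_gt_of_ne ht with h | h
  · rw [Real.sign_of_neg h]; norm_num
  · rw [Real.sign_of_pos h]; norm_num

theorem orderSign_mul_self {m : ℕ} {y : Fin m → ℝ} (hy : Function.Injective y) :
    orderSign y * orderSign y = 1 := by
  simp only [orderSign, ← Finset.prod_mul_distrib]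
  refine Finset.prod_eq_one fun j _ => Finset.prod_eq_one fun k hk => ?_
  refine sign_mul_self_of_ne_zero (sub_ne_zero.2 fun h => ?_)
  exact (Finset.mem_Ioi.1 hk).ne' (hy h)

theorem signFactor_eq {n : ℕ} (x' x'' : Fin n → ℝ) :
    signFactor x' x'' = orderSign x' * orderSign x'' := by
  simp only [signFactor, orderSign, Finset.prod_mul_distrib]

theorem prod_range_add_self (f : ℕ → ℝ) (n : ℕ) :
    ∏ i ∈ Finset.range (n + n), f i = ∏ j ∈ Finset.range n, (f (2 * j) * f (2 * j + 1)) := by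
  induction n with
  | zero => simp
  | succ n ih =>
    rw [show n + 1 + (n + 1) = n + n + 1 + 1 by ring, Finset.prod_range_succ,
      Finset.prod_range_succ, Finset.prod_range_succ, ih, two_mul, mul_assoc]

theorem prod_fin_add_self {n : ℕ} (f : Fin (n + n) → ℝ) :
    ∏ i, f i = ∏ j : Fin n, (f ⟨2 * (j : ℕ), by omega⟩ * f ⟨2 * (j : ℕ) + 1, by omega⟩) := by
  let g : ℕ → ℝ := fun i => if h : i < n + n then f ⟨i, h⟩ else 1
  have h := prod_range_add_self g n
  rw [Finset.prod_range, Finset.prod_range] at h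
  have e1 : ∏ i : Fin (n + n), g i = ∏ i, f i :=
    Finset.prod_congr rfl fun i _ => by simp [g]
  rw [← e1, h]
  refine Finset.prod_congr rfl fun j _ => ?_
  have hj := j.2
  simp only [g]
  rw [dif_pos (by omega), dif_pos (by omega)]

/-- Group the sorted points in consecutive pairs. A pair contributes -1 if t lies strictly between
its two points and 1 otherwise. The intervals meet at most in endpoints, which t avoids, so at most
one pair contributes -1. -/
theorem prod_sign_sub_of_monotone {n : ℕ} {s : Fin (n + n) → ℝ} (hs : Monotone s) {t : ℝ}
    (ht : ∀ i, t ≠ s i) :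
    ∏ i, Real.sign (t - s i) =
      1 + (⋃ j : Fin n, Set.Icc (s ⟨2 * (j : ℕ), by omega⟩)
        (s ⟨2 * (j : ℕ) + 1, by omega⟩)).indicator (fun _ => (-2 : ℝ)) t := by
  rw [prod_fin_add_self]
  have hout : ∀ j : Fin n, t ∉ Set.Icc (s ⟨2 * (j : ℕ), by omega⟩) (s ⟨2 * (j : ℕ) + 1, by omega⟩) →
      Real.sign (t - s ⟨2 * (j : ℕ), by omega⟩) * Real.sign (t - s ⟨2 * (j : ℕ) + 1, by omega⟩) =
        1 := by
    intro j hj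
    have hle : s ⟨2 * (j : ℕ), by omega⟩ ≤ s ⟨2 * (j : ℕ) + 1, by omega⟩ :=
      hs (by simp [Fin.le_def])
    rw [Set.mem_Icc, not_and_or, not_le, not_le] at hj
    rcases hj with h | h
    · rw [Real.sign_of_neg (by linarith), Real.sign_of_neg (by linarith)]; norm_num
    · rw [Real.sign_of_pos (by linarith), Real.sign_of_pos (by linarith)]; norm_num
  by_cases hmem : t ∈ ⋃ j : Fin n, Set.Icc (s ⟨2 * (j : ℕ), by omega⟩)
      (s ⟨2 * (j : ℕ) + 1, by omega⟩)
  · rw [Set.indicator_of_mem hmem]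
    obtain ⟨j, hj⟩ := Set.mem_iUnion.1 hmem
    have hlt1 : s ⟨2 * (j : ℕ), by omega⟩ < t := lt_of_le_of_ne hj.1 (ht _).symm
    have hlt2 : t < s ⟨2 * (j : ℕ) + 1, by omega⟩ := lt_of_le_of_ne hj.2 (ht _)
    rw [Finset.prod_eq_single j]
    · rw [Real.sign_of_pos (sub_pos.2 hlt1), Real.sign_of_neg (sub_neg.2 hlt2)]
      norm_num
    · intro i _ hij
      refine hout i fun hi => ?_
      rcases lt_or_gt_of_ne hij with h | h
      · have h1 : s ⟨2 * (i : ℕ) + 1, by omega⟩ ≤ s ⟨2 * (j : ℕ), by omega⟩ :=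
          hs (by simp only [Fin.le_def]; omega)
        linarith [hi.2]
      · have h1 : s ⟨2 * (j : ℕ) + 1, by omega⟩ ≤ s ⟨2 * (i : ℕ), by omega⟩ :=
          hs (by simp only [Fin.le_def]; omega)
        linarith [hi.1]
    · simp
  · rw [Set.indicator_of_notMem hmem, add_zero]
    refine Finset.prod_eq_one fun j _ => hout j fun hj => hmem (Set.mem_iUnion.2 ⟨j, hj⟩)

/-- The weight `1 - 2 · 1_{I_p}` arises as `1` plus this function. -/
noncomputable def flipWeight {n : ℕ} (x' x'' : Fin n → ℝ) : ℝ → ℝ :=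
  (intervalUnion x' x'').indicator fun _ => (-2 : ℝ)

theorem prod_sign_mul_prod_sign {n : ℕ} {x' x'' : Fin n → ℝ} {t : ℝ} (h' : ∀ i, t ≠ x' i)
    (h'' : ∀ i, t ≠ x'' i) :
    (∏ i, Real.sign (t - x' i)) * ∏ i, Real.sign (t - x'' i) = 1 + flipWeight x' x'' t := by
  have hne : ∀ i, t ≠ Fin.append x' x'' i := by
    intro i
    cases i using Fin.addCases with
    | left i => simpa using h' i
    | right i => rw [Fin.append_right]; exact h'' i
  have h := prod_sign_sub_of_monotone (s := sortedPoints x' x'') (Tuple.monotone_sort _)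
    (t := t) fun i => hne _
  rw [flipWeight, intervalUnion, ← h]
  have hperm := Equiv.prod_comp (Tuple.sort (Fin.append x' x''))
    fun i => Real.sign (t - Fin.append x' x'' i)
  refine Eq.trans ?_ hperm.symm
  simp only [Fin.prod_univ_add, Fin.append_left, Fin.append_right]

theorem abs_det_mode_mul_abs_det_mode {L : ℝ} (hL : 0 < L) (ε : Boundary) {n N : ℕ}
    {x' x'' : Fin n → ℝ} {y : Fin N → ℝ} (hx' : ∀ k, x' k ∈ Set.Icc 0 L)
    (hx'' : ∀ k, x'' k ∈ Set.Icc 0 L) (hy : ∀ k, y k ∈ Set.Icc 0 L) :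
    |(Matrix.of fun j k : Fin (n + N) => mode ε L j (Fin.append x' y k)).det| *
      |(Matrix.of fun j k : Fin (n + N) => mode ε L j (Fin.append x'' y k)).det| =
    signFactor x' x'' *
      ((Matrix.of fun j k : Fin (n + N) => mode ε L j (Fin.append x' y k)).det *
      (Matrix.of fun j k : Fin (n + N) => mode ε L j (Fin.append x'' y k)).det *
      ∏ k, (1 + flipWeight x' x'' (y k))) := by
  have hmem : ∀ x : Fin n → ℝ, (∀ k, x k ∈ Set.Icc 0 L) →
      ∀ k, Fin.append x y k ∈ Set.Icc 0 L := by
    intro x hx k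
    cases k using Fin.addCases with
    | left k => simpa using hx k
    | right k => simpa using hy k
  have hinj : ∀ x : Fin n → ℝ,
      (Matrix.of fun j k : Fin (n + N) => mode ε L j (Fin.append x y k)).det ≠ 0 →
      Function.Injective (Fin.append x y) := by
    intro x hx a b hab
    by_contra hne
    refine hx (Matrix.det_zero_of_column_eq hne fun j => ?_)
    simp [hab]
  have hA := abs_det_mode hL ε (hmem x' hx')
  have hB := abs_det_mode hL ε (hmem x'' hx'')
  have hi' := hinj x'
  have hi'' := hinj x''
  generalize (Matrix.of fun j k : Fin (n + N) => mode ε L j (Fin.append x' y k)).det = A at *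
  generalize (Matrix.of fun j k : Fin (n + N) => mode ε L j (Fin.append x'' y k)).det = B at *
  -- If a determinant vanishes both sides are zero. Otherwise all points are distinct, so no sgn(0)
  -- occurs and no y_k is an endpoint of I_p.
  by_cases hA0 : A = 0
  · simp [hA0]
  by_cases hB0 : B = 0
  · simp [hB0]
  have hs : (∏ j : Fin (n + N), ∏ _k ∈ Finset.Ioi j, (-1 : ℝ)) *
      (∏ j : Fin (n + N), ∏ _k ∈ Finset.Ioi j, (-1 : ℝ)) = 1 := by
    simp only [← Finset.prod_mul_distrib]
    norm_num
  have hyinj : Function.Injective y := by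
    intro a b hab
    have := hi' hA0 (a₁ := Fin.natAdd n a) (a₂ := Fin.natAdd n b) (by simpa using hab)
    simpa using this
  have hne : ∀ x : Fin n → ℝ, Function.Injective (Fin.append x y) → ∀ k i, y k ≠ x i := by
    intro x hx k i h
    have := hx (a₁ := Fin.natAdd n k) (a₂ := Fin.castAdd N i) (by simpa using h)
    have := congrArg Fin.val this
    simp at this
    omega
  have hy1 := orderSign_mul_self hyinj
  rw [hA, hB, orderSign_append, orderSign_append, signFactor_eq]
  simp only [← prod_sign_mul_prod_sign (hne x' (hi' hA0) _) (hne x'' (hi'' hB0) _),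
    Finset.prod_mul_distrib]
  generalize (∏ j : Fin (n + N), ∏ _k ∈ Finset.Ioi j, (-1 : ℝ)) = s at *
  linear_combination (A * B * orderSign x' * orderSign x'' *
    (∏ k, ∏ i, Real.sign (y k - x' i)) * (∏ k, ∏ i, Real.sign (y k - x'' i))) *
    (orderSign y * orderSign y * hs + hy1)

end OrderSign

/-! ### Orthogonality of the modes -/

section Orthogonality

theorem integral_cos_int_mul {L : ℝ} (hL : 0 < L) (k : ℤ) :
    ∫ x in Set.Icc 0 L, Real.cos (k * (Real.pi * x / L)) = if k = 0 then L else 0 := by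
  rw [integral_Icc_eq_integral_Ioc, ← intervalIntegral.integral_of_le hL.le]
  split_ifs with hk
  · simp [hk]
  · have hc : (k * Real.pi / L : ℝ) ≠ 0 :=
      div_ne_zero (mul_ne_zero (Int.cast_ne_zero.2 hk) Real.pi_ne_zero) hL.ne'
    have h : ∀ x : ℝ, Real.cos (k * (Real.pi * x / L)) = Real.cos (k * Real.pi / L * x) := by
      intro x
      congr 1
      ring
    simp only [h]
    rw [intervalIntegral.integral_comp_mul_left (fun x => Real.cos x) hc, integral_cos,
      div_mul_cancel₀ _ hL.ne', Real.sin_int_mul_pi]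
    simp

/-- The reciprocal of the squared norm of `mode ε L j`. -/
noncomputable def modeWeight (ε : Boundary) (L : ℝ) (j : ℕ) : ℝ :=
  match ε with
  | .neumann => if j = 0 then 1 / L else 2 / L
  | .dirichlet => 2 / L

theorem modeWeight_pos {L : ℝ} (hL : 0 < L) (ε : Boundary) (j : ℕ) : 0 < modeWeight ε L j := by
  cases ε with
  | neumann => simp only [modeWeight]; split_ifs <;> positivity
  | dirichlet => simp only [modeWeight]; positivity

theorem modeWeight_le {L : ℝ} (hL : 0 < L) (ε : Boundary) (j : ℕ) : modeWeight ε L j ≤ 2 / L := by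
  cases ε with
  | neumann =>
    simp only [modeWeight]
    split_ifs
    · gcongr; norm_num
    · exact le_rfl
  | dirichlet => exact le_rfl

theorem continuous_mode (ε : Boundary) (L : ℝ) (j : ℕ) : Continuous (mode ε L j) := by
  cases ε <;> (unfold mode; fun_prop)

theorem abs_mode_le_one (ε : Boundary) (L : ℝ) (j : ℕ) (x : ℝ) : |mode ε L j x| ≤ 1 := by
  cases ε with
  | neumann => exact Real.abs_cos_le_one _
  | dirichlet => exact Real.abs_sin_le_one _

theorem integral_mode_mul_mode {L : ℝ} (hL : 0 < L) (ε : Boundary) (i j : ℕ) :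
    modeWeight ε L i * ∫ x in Set.Icc 0 L, mode ε L i x * mode ε L j x =
      if i = j then 1 else 0 := by
  have hint : ∀ k : ℤ, Integrable (fun x : ℝ => Real.cos (k * (Real.pi * x / L)))
      (volume.restrict (Set.Icc 0 L)) := fun k =>
    (by fun_prop : Continuous fun x : ℝ => Real.cos (k * (Real.pi * x / L))).integrableOn_Icc
  cases ε with
  | neumann =>
    have h : ∀ x, mode .neumann L i x * mode .neumann L j x =
        2⁻¹ * (Real.cos (((i : ℤ) - j : ℤ) * (Real.pi * x / L)) +
          Real.cos (((i : ℤ) + j : ℤ) * (Real.pi * x / L))) := by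
      intro x
      simp only [mode]
      push_cast
      rw [sub_mul, add_mul, Real.cos_sub, Real.cos_add]
      ring
    simp only [h]
    rw [integral_const_mul, integral_add (hint _) (hint _), integral_cos_int_mul hL,
      integral_cos_int_mul hL]
    simp only [modeWeight]
    by_cases hij : i = j
    · subst hij
      by_cases hi : i = 0
      · subst hi; simp; field_simp; norm_num
      · have : ((i : ℤ) + i) ≠ 0 := by omega
        simp [hi, this]; field_simp
    · have h1 : ((i : ℤ) - j) ≠ 0 := by omega
      have h2 : ((i : ℤ) + j) ≠ 0 := by omega
      simp [hij, h1, h2]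
  | dirichlet =>
    have h : ∀ x, mode .dirichlet L i x * mode .dirichlet L j x =
        2⁻¹ * (Real.cos (((i : ℤ) - j : ℤ) * (Real.pi * x / L)) -
          Real.cos (((i : ℤ) + j + 2 : ℤ) * (Real.pi * x / L))) := by
      intro x
      simp only [mode]
      push_cast
      rw [show ((i : ℝ) - j) * (Real.pi * x / L) = (i + 1) * (Real.pi * x / L) -
        (j + 1) * (Real.pi * x / L) by ring, show ((i : ℝ) + j + 2) * (Real.pi * x / L) =
        (i + 1) * (Real.pi * x / L) + (j + 1) * (Real.pi * x / L) by ring,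
        Real.cos_sub, Real.cos_add]
      ring
    simp only [h]
    rw [integral_const_mul, integral_sub (hint _) (hint _), integral_cos_int_mul hL,
      integral_cos_int_mul hL]
    simp only [modeWeight]
    have h2 : ((i : ℤ) + j + 2) ≠ 0 := by omega
    by_cases hij : i = j
    · subst hij
      simp [h2]; field_simp
    · have h1 : ((i : ℤ) - j) ≠ 0 := by omega
      simp [hij, h1, h2]

end Orthogonality

/-! ### The projection kernel and the finite-volume Fredholm sum -/

section ModeKernel

/-- The kernel of the projection onto the first `M` one-particle wave functions. -/
noncomputable def modeKernel (ε : Boundary) (L : ℝ) (M : ℕ) (x y : ℝ) : ℝ :=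
  ∑ j : Fin M, modeWeight ε L j * (mode ε L j x * mode ε L j y)

theorem measurable_modeKernel (ε : Boundary) (L : ℝ) (M : ℕ) :
    Measurable (Function.uncurry (modeKernel ε L M)) := by
  refine Continuous.measurable ?_
  simp only [Function.uncurry_def, modeKernel]
  refine continuous_finsetSum _ fun j _ => continuous_const.mul ?_
  exact ((continuous_mode ε L j).comp continuous_fst).mul
    ((continuous_mode ε L j).comp continuous_snd)

theorem abs_modeKernel_le {L : ℝ} (hL : 0 < L) (ε : Boundary) (M : ℕ) (x y : ℝ) :
    |modeKernel ε L M x y| ≤ 2 * (M / L) := by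
  calc |modeKernel ε L M x y| ≤ ∑ _j : Fin M, 2 / L := by
        refine (Finset.abs_sum_le_sum_abs _ _).trans (Finset.sum_le_sum fun j _ => ?_)
        rw [abs_mul, abs_mul, abs_of_pos (modeWeight_pos hL ε j)]
        calc modeWeight ε L j * (|mode ε L j x| * |mode ε L j y|) ≤ 2 / L * (1 * 1) := by
              gcongr
              · exact modeWeight_le hL ε j
              · exact abs_mode_le_one _ _ _ _
              · exact abs_mode_le_one _ _ _ _
          _ = 2 / L := by ring
    _ = 2 * (M / L) := by simp; ring

theorem integrable_mode_mul_mode (ε : Boundary) (L : ℝ) (i j : ℕ) :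
    Integrable (fun t => mode ε L i t * mode ε L j t) (volume.restrict (Set.Icc 0 L)) :=
  ((continuous_mode ε L i).mul (continuous_mode ε L j)).integrableOn_Icc

theorem integral_modeKernel_mul_modeKernel {L : ℝ} (hL : 0 < L) (ε : Boundary) (M : ℕ)
    (x y : ℝ) :
    ∫ t in Set.Icc 0 L, modeKernel ε L M x t * modeKernel ε L M t y = modeKernel ε L M x y := by
  have h : ∀ t, modeKernel ε L M x t * modeKernel ε L M t y =
      ∑ i : Fin M, ∑ j : Fin M, (mode ε L i x * (modeWeight ε L j * mode ε L j y)) *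
        (modeWeight ε L i * (mode ε L i t * mode ε L j t)) := by
    intro t
    rw [modeKernel, modeKernel, Finset.sum_mul_sum]
    exact Finset.sum_congr rfl fun i _ => Finset.sum_congr rfl fun j _ => by ring
  have hint : ∀ i j : Fin M, Integrable (fun t =>
      (mode ε L i x * (modeWeight ε L j * mode ε L j y)) *
        (modeWeight ε L i * (mode ε L i t * mode ε L j t))) (volume.restrict (Set.Icc 0 L)) :=
    fun i j => ((integrable_mode_mul_mode ε L i j).const_mul _).const_mul _
  simp only [h]
  rw [integral_finsetSum _ fun i _ => integrable_finsetSum _ fun j _ => hint i j, modeKernel]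
  refine Finset.sum_congr rfl fun i _ => ?_
  rw [integral_finsetSum _ fun j _ => hint i j]
  simp only [integral_const_mul, integral_mode_mul_mode hL, Fin.val_inj]
  simp
  ring

theorem integral_modeKernel_diag {L : ℝ} (hL : 0 < L) (ε : Boundary) (M : ℕ) :
    ∫ t in Set.Icc 0 L, modeKernel ε L M t t = M := by
  simp only [modeKernel]
  rw [integral_finsetSum _ fun (j : Fin M) _ => (integrable_mode_mul_mode ε L j j).const_mul _]
  simp [integral_const_mul, integral_mode_mul_mode hL]

/-- The kernel matrix factors as (transposed mode matrix at u) · (diagonal of weights) · (mode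
matrix at v). -/
theorem prod_modeWeight_mul_det_mul_det (ε : Boundary) (L : ℝ) {M : ℕ} (u v : Fin M → ℝ) :
    (∏ j : Fin M, modeWeight ε L j) *
      ((Matrix.of fun j k : Fin M => mode ε L j (u k)).det *
      (Matrix.of fun j k : Fin M => mode ε L j (v k)).det) =
    (Matrix.of fun i j : Fin M => modeKernel ε L M (u i) (v j)).det := by
  rw [← Matrix.det_diagonal, ← Matrix.det_transpose (Matrix.of fun j k : Fin M =>
    mode ε L j (u k)), ← mul_assoc, mul_comm (Matrix.det (Matrix.diagonal _)),
    ← Matrix.det_mul, ← Matrix.det_mul]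
  congr 1
  ext i j
  rw [Matrix.mul_apply]
  simp only [Matrix.mul_diagonal, Matrix.transpose_apply, Matrix.of_apply, modeKernel]
  exact Finset.sum_congr rfl fun k _ => by ring

theorem integral_box {N : ℕ} (L : ℝ) (f : (Fin N → ℝ) → ℝ) :
    ∫ y in box N L, f y = ∫ y, f y ∂(Measure.pi fun _ => volume.restrict (Set.Icc 0 L)) := by
  rw [box, volume_pi, Measure.restrict_pi_pi]

/-- The determinantal expansion with no fixed points and h = 0: only the term l = 0 survives, and it
equals M!. -/
theorem normalization_eq {L : ℝ} (hL : 0 < L) (ε : Boundary) (M : ℕ) :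
    (∏ j : Fin M, modeWeight ε L j) * normalization M L ε.param ε.param = M.factorial := by
  have hC := abs_modeKernel_le hL ε M
  have h := integral_kernelDet_mul_prod_one_add (n := 0) (N := M) (h := fun _ => 0) (B := 0)
    (measurable_modeKernel ε L M) hC (integral_modeKernel_mul_modeKernel hL ε M)
    (by rw [zero_add]; exact integral_modeKernel_diag hL ε M) Fin.elim0 Fin.elim0
    measurable_const (by simp)
  have hdet : ∀ z : Fin M → ℝ, kernelDet (modeKernel ε L M) Fin.elim0 Fin.elim0 z =
      (∏ j : Fin M, modeWeight ε L j) * orbitalDet M L ε.param ε.param z ^ 2 := by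
    intro z
    rw [orbitalDet_eq hL, pow_two, prod_modeWeight_mul_det_mul_det, kernelDet,
      ← Matrix.det_submatrix_equiv_self (finCongr (zero_add M))]
    congr 1
    ext i j
    simp [Fin.elim0_append]
  rw [Finset.sum_range_succ', Finset.sum_eq_zero] at h
  · simp only [add_zero, Finset.prod_const_one, mul_one, hdet, integral_const_mul] at h
    rw [normalization, integral_box, h]
    simp [kernelDet, measureReal_def]
  · intro l _
    simp

theorem sortedPoints_mem {n : ℕ} {x' x'' : Fin n → ℝ} {S : Set ℝ} (hx' : ∀ k, x' k ∈ S)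
    (hx'' : ∀ k, x'' k ∈ S) (i : Fin (n + n)) : sortedPoints x' x'' i ∈ S := by
  simp only [sortedPoints, Function.comp]
  generalize Tuple.sort (Fin.append x' x'') i = j
  cases j using Fin.addCases with
  | left j => rw [Fin.append_left]; exact hx' j
  | right j => rw [Fin.append_right]; exact hx'' j

theorem intervalUnion_subset {n : ℕ} {x' x'' : Fin n → ℝ} {L : ℝ}
    (hx' : ∀ k, x' k ∈ Set.Icc 0 L) (hx'' : ∀ k, x'' k ∈ Set.Icc 0 L) :
    intervalUnion x' x'' ⊆ Set.Icc 0 L :=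
  Set.iUnion_subset fun _ => Set.Icc_subset_Icc (sortedPoints_mem hx' hx'' _).1
    (sortedPoints_mem hx' hx'' _).2

theorem measurableSet_intervalUnion {n : ℕ} (x' x'' : Fin n → ℝ) :
    MeasurableSet (intervalUnion x' x'') :=
  MeasurableSet.iUnion fun _ => measurableSet_Icc

theorem integral_mul_prod_flipWeight {n l : ℕ} {x' x'' : Fin n → ℝ} {L : ℝ}
    (hx' : ∀ k, x' k ∈ Set.Icc 0 L) (hx'' : ∀ k, x'' k ∈ Set.Icc 0 L)
    (f : (Fin l → ℝ) → ℝ) :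
    ∫ y, f y * ∏ k, flipWeight x' x'' (y k)
        ∂(Measure.pi fun _ : Fin l => volume.restrict (Set.Icc 0 L)) =
      (-2) ^ l * ∫ z in Set.univ.pi fun _ : Fin l => intervalUnion x' x'', f z := by
  have hprod : ∀ y : Fin l → ℝ, f y * ∏ k, flipWeight x' x'' (y k) =
      (Set.univ.pi fun _ : Fin l => intervalUnion x' x'').indicator
        (fun y => (-2) ^ l * f y) y := by
    intro y
    by_cases hy : y ∈ Set.univ.pi fun _ : Fin l => intervalUnion x' x''
    · rw [Set.indicator_of_mem hy]
      have : ∀ k, flipWeight x' x'' (y k) = -2 := fun k =>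
        Set.indicator_of_mem (hy k (Set.mem_univ k)) _
      simp [this, mul_comm]
    · rw [Set.indicator_of_notMem hy]
      simp only [Set.mem_pi, Set.mem_univ, true_implies, not_forall] at hy
      obtain ⟨k, hk⟩ := hy
      rw [Finset.prod_eq_zero (Finset.mem_univ k) (Set.indicator_of_notMem hk _), mul_zero]
  simp only [hprod]
  rw [← integral_box, setIntegral_indicator
    (MeasurableSet.univ_pi fun _ => measurableSet_intervalUnion x' x''),
    Set.inter_eq_self_of_subset_right, integral_const_mul]
  exact Set.pi_mono fun _ _ => intervalUnion_subset hx' hx''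

/-- The correlation functions of a finite system as finite Fredholm-type sums. -/
theorem correlation_eq_sum {L : ℝ} (hL : 0 < L) (ε : Boundary) {n : ℕ} (N : ℕ)
    {x' x'' : Fin n → ℝ} (hx' : ∀ k, x' k ∈ Set.Icc 0 L) (hx'' : ∀ k, x'' k ∈ Set.Icc 0 L) :
    correlation n N L ε x' x'' = signFactor x' x'' * ∑ l ∈ Finset.range (N + 1),
      (-2) ^ l / (l.factorial : ℝ) * ∫ z in Set.univ.pi fun _ : Fin l => intervalUnion x' x'',
        kernelDet (modeKernel ε L (n + N)) x' x'' z := by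
  have hfin := integral_kernelDet_mul_prod_one_add (n := n) (N := N) (B := 2)
    (measurable_modeKernel ε L (n + N)) (abs_modeKernel_le hL ε (n + N))
    (integral_modeKernel_mul_modeKernel hL ε (n + N)) (integral_modeKernel_diag hL ε (n + N))
    x' x'' (h := flipWeight x' x'')
    (measurable_const.indicator (measurableSet_intervalUnion x' x''))
    (fun t => by
      by_cases h : t ∈ intervalUnion x' x''
      · simp [flipWeight, h]
      · simp [flipWeight, h])
  have hV := normalization_eq hL ε (n + N)
  have hwpos : 0 < ∏ j : Fin (n + N), modeWeight ε L j :=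
    Finset.prod_pos fun j _ => modeWeight_pos hL ε j
  -- Positivity of V is read off from the identity with (n + N)!.
  have hVpos : 0 < normalization (n + N) L ε.param ε.param := by
    have : (0 : ℝ) < (n + N).factorial := by positivity
    rw [← hV] at this
    exact pos_of_mul_pos_right this hwpos.le
  have hpt : ∀ y ∈ box N L, waveFunction (n + N) L ε.param ε.param (Fin.append x' y) *
      waveFunction (n + N) L ε.param ε.param (Fin.append x'' y) =
      signFactor x' x'' / (n + N).factorial *
        (kernelDet (modeKernel ε L (n + N)) x' x'' y * ∏ k, (1 + flipWeight x' x'' (y k))) := by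
    intro y hy
    have h := abs_det_mode_mul_abs_det_mode hL ε hx' hx'' (y := y) fun k => hy k (Set.mem_univ k)
    simp only [waveFunction, orbitalDet_eq hL]
    rw [mul_mul_mul_comm, h, kernelDet, ← prod_modeWeight_mul_det_mul_det, ← hV,
      div_mul_div_comm, Real.mul_self_sqrt hVpos.le]
    have := hwpos.ne'
    have := hVpos.ne'
    field_simp
  have hbox : MeasurableSet (box N L) := MeasurableSet.univ_pi fun _ => measurableSet_Icc
  rw [correlation, densityMatrix, setIntegral_congr_fun hbox hpt, integral_const_mul,
    integral_box, hfin, Finset.mul_sum, Finset.mul_sum, Finset.mul_sum]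
  refine Finset.sum_congr rfl fun l _ => ?_
  rw [integral_mul_prod_flipWeight hx' hx'']
  have h1 : ((n + N).factorial : ℝ) ≠ 0 := by positivity
  have h2 : (N.factorial : ℝ) ≠ 0 := by positivity
  field_simp

end ModeKernel

/-! ### The Dirichlet kernel and its scaling limit -/

section CosineSum

/-- The telescoping identity after multiplication by 2 sin(a/2). Written with sinc it also covers a
= 0, that is, coinciding arguments. -/
theorem sum_cos_mul_sinc (a : ℝ) (m : ℕ) :
    (∑ j ∈ Finset.range m, Real.cos ((j + 1) * a)) * Real.sinc (a / 2) =
      (m + 1 / 2) * Real.sinc ((m + 1 / 2) * a) - 1 / 2 * Real.sinc (a / 2) := by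
  by_cases ha : a = 0
  · simp [ha]
  have hm : ((m : ℝ) + 1 / 2) ≠ 0 := by positivity
  have key : (∑ j ∈ Finset.range m, Real.cos ((j + 1) * a)) * (2 * Real.sin (a / 2)) =
      Real.sin ((m + 1 / 2) * a) - Real.sin (a / 2) := by
    clear hm
    induction m with
    | zero => simp; ring_nf
    | succ m ih =>
      rw [Finset.sum_range_succ, add_mul, ih]
      push_cast
      rw [show ((m : ℝ) + 1 + 1 / 2) * a = (m + 1) * a + a / 2 by ring,
        show ((m : ℝ) + 1 / 2) * a = (m + 1) * a - a / 2 by ring, Real.sin_add, Real.sin_sub]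
      ring
  rw [Real.sinc_of_ne_zero (div_ne_zero ha two_ne_zero), Real.sinc_of_ne_zero (mul_ne_zero hm ha)]
  rw [← mul_div_assoc _ (Real.sin _) (_ * a), mul_div_mul_left _ _ hm]
  generalize ∑ j ∈ Finset.range m, Real.cos ((j + 1) * a) = S at *
  generalize Real.sin ((m + 1 / 2) * a) = X at *
  field_simp
  linear_combination key

theorem tendsto_sum_cos_div {ι : Type*} {F : Filter ι} {L : ι → ℝ} {m : ι → ℕ} {ρ : ℝ}
    (hL : Tendsto L F atTop) (hm : Tendsto (fun i => (m i : ℝ) / L i) F (𝓝 ρ)) (t : ℝ) :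
    Tendsto (fun i => 1 / L i * ∑ j ∈ Finset.range (m i),
      Real.cos ((j + 1) * (Real.pi * t / L i))) F (𝓝 (ρ * Real.sinc (ρ * Real.pi * t))) := by
  have hinv : Tendsto (fun i => 1 / L i) F (𝓝 0) := tendsto_const_nhds.div_atTop hL
  have ha : Tendsto (fun i => Real.sinc (Real.pi * t / L i / 2)) F (𝓝 1) := by
    have h0 : Tendsto (fun i => Real.pi * t / L i / 2) F (𝓝 0) := by
      have := (tendsto_const_nhds (x := Real.pi * t)).div_atTop hL
      simpa using this.div_const 2
    simpa [Function.comp_def] using (Real.continuous_sinc.tendsto 0).comp h0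
  have hm' : Tendsto (fun i => (m i : ℝ) / L i + 1 / 2 * (1 / L i)) F (𝓝 ρ) := by
    have h := hm.add (hinv.const_mul (1 / 2))
    rwa [mul_zero, add_zero] at h
  have hnum : Tendsto (fun i => ((m i : ℝ) / L i + 1 / 2 * (1 / L i)) *
      Real.sinc (((m i : ℝ) / L i + 1 / 2 * (1 / L i)) * Real.pi * t) -
      1 / 2 * (1 / L i) * Real.sinc (Real.pi * t / L i / 2)) F
      (𝓝 (ρ * Real.sinc (ρ * Real.pi * t))) := by
    have h1 := hm'.mul ((Real.continuous_sinc.tendsto _).comp ((hm'.mul_const Real.pi).mul_const t))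
    have h := h1.sub ((hinv.const_mul (1 / 2)).mul ha)
    rwa [mul_zero, zero_mul, sub_zero] at h
  have hdiv := hnum.div ha one_ne_zero
  rw [div_one] at hdiv
  refine hdiv.congr' ?_
  filter_upwards [ha.eventually_ne one_ne_zero] with i hi
  rw [Pi.div_apply, div_eq_iff hi, mul_assoc (1 / L i), sum_cos_mul_sinc,
    show ((m i : ℝ) / L i + 1 / 2 * (1 / L i)) * Real.pi * t =
      ((m i : ℝ) + 1 / 2) * (Real.pi * t / L i) by ring]
  ring

end CosineSum

/-! ### Pointwise limit of the projection kernel -/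

section KernelLimit

theorem modeKernel_dirichlet_eq (L : ℝ) (M : ℕ) (x y : ℝ) :
    modeKernel .dirichlet L M x y =
      1 / L * ∑ j ∈ Finset.range M, Real.cos ((j + 1) * (Real.pi * (x - y) / L)) -
      1 / L * ∑ j ∈ Finset.range M, Real.cos ((j + 1) * (Real.pi * (x + y) / L)) := by
  rw [← mul_sub, ← Finset.sum_sub_distrib, Finset.mul_sum, Finset.sum_range, modeKernel]
  refine Finset.sum_congr rfl fun j _ => ?_
  simp only [modeWeight, mode]
  rw [show ((j : ℝ) + 1) * (Real.pi * (x - y) / L) =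
      (j + 1) * (Real.pi * x / L) - (j + 1) * (Real.pi * y / L) by ring,
    show ((j : ℝ) + 1) * (Real.pi * (x + y) / L) =
      (j + 1) * (Real.pi * x / L) + (j + 1) * (Real.pi * y / L) by ring,
    Real.cos_sub, Real.cos_add]
  ring

theorem modeKernel_neumann_succ_eq (L : ℝ) (M : ℕ) (x y : ℝ) :
    modeKernel .neumann L (M + 1) x y = 1 / L +
      (1 / L * ∑ j ∈ Finset.range M, Real.cos ((j + 1) * (Real.pi * (x - y) / L)) +
      1 / L * ∑ j ∈ Finset.range M, Real.cos ((j + 1) * (Real.pi * (x + y) / L))) := by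
  rw [← mul_add, ← Finset.sum_add_distrib, Finset.mul_sum, Finset.sum_range, modeKernel,
    Fin.sum_univ_succ]
  congr 1
  · simp [modeWeight, mode]
  refine Finset.sum_congr rfl fun j _ => ?_
  simp only [modeWeight, mode, Fin.val_succ, Nat.succ_ne_zero, if_false]
  push_cast
  rw [show ((j : ℝ) + 1) * (Real.pi * (x - y) / L) =
      (j + 1) * (Real.pi * x / L) - (j + 1) * (Real.pi * y / L) by ring,
    show ((j : ℝ) + 1) * (Real.pi * (x + y) / L) =
      (j + 1) * (Real.pi * x / L) + (j + 1) * (Real.pi * y / L) by ring,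
    Real.cos_sub, Real.cos_add]
  ring

/-- Dominated convergence for integrals along a filter requires a countable basis. -/
instance (ρ₀ : ℝ) : (thermodynamicLimit ρ₀).IsCountablyGenerated := by
  unfold thermodynamicLimit
  infer_instance

theorem tendsto_fst_thermodynamicLimit (ρ₀ : ℝ) :
    Tendsto Prod.fst (thermodynamicLimit ρ₀) atTop :=
  tendsto_fst.mono_left inf_le_left

theorem tendsto_snd_thermodynamicLimit (ρ₀ : ℝ) :
    Tendsto Prod.snd (thermodynamicLimit ρ₀) atTop :=
  tendsto_snd.mono_left inf_le_left

theorem eventually_density_eq (ρ₀ : ℝ) :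
    ∀ᶠ p : ℕ × ℝ in thermodynamicLimit ρ₀, (p.1 : ℝ) / p.2 = ρ₀ :=
  mem_inf_of_right (mem_principal_self _)

theorem tendsto_modeKernel (ρ₀ : ℝ) (ε : Boundary) (n : ℕ) (x y : ℝ) :
    Tendsto (fun p : ℕ × ℝ => modeKernel ε p.2 (n + p.1) x y) (thermodynamicLimit ρ₀)
      (𝓝 (Real.pi⁻¹ * limitKernel ρ₀ ε x y)) := by
  have hL := tendsto_snd_thermodynamicLimit ρ₀
  have hN : Tendsto (fun p : ℕ × ℝ => (p.1 : ℝ) / p.2) (thermodynamicLimit ρ₀) (𝓝 ρ₀) :=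
    tendsto_const_nhds.congr' ((eventually_density_eq ρ₀).mono fun _ h => h.symm)
  have hinv : ∀ c : ℝ, Tendsto (fun p : ℕ × ℝ => c / p.2) (thermodynamicLimit ρ₀) (𝓝 0) :=
    fun c => tendsto_const_nhds.div_atTop hL
  have hM : Tendsto (fun p : ℕ × ℝ => ((n + p.1 : ℕ) : ℝ) / p.2) (thermodynamicLimit ρ₀)
      (𝓝 ρ₀) := by
    have := (hinv n).add hN
    rw [zero_add] at this
    refine this.congr fun p => ?_
    push_cast
    ring
  have hpi := Real.pi_ne_zero
  cases ε with
  | dirichlet =>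
    simp only [modeKernel_dirichlet_eq]
    have h := (tendsto_sum_cos_div hL hM (x - y)).sub (tendsto_sum_cos_div hL hM (x + y))
    convert h using 2
    simp only [limitKernel, Boundary.sign]
    field_simp
    ring
  | neumann =>
    -- In the Neumann case the constant mode splits off with the vanishing weight 1/L, which leaves
    -- n + N - 1 cosines. The natural subtraction is genuine once N ≥ 1.
    have hM' : Tendsto (fun p : ℕ × ℝ => ((n + p.1 - 1 : ℕ) : ℝ) / p.2) (thermodynamicLimit ρ₀)
        (𝓝 ρ₀) := by
      have := hM.sub (hinv 1)
      rw [sub_zero] at this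
      refine this.congr' ?_
      filter_upwards [(tendsto_fst_thermodynamicLimit ρ₀).eventually_ge_atTop 1] with p hp
      rw [Nat.cast_sub (by omega), Nat.cast_one]
      ring
    have h := (hinv 1).add
      ((tendsto_sum_cos_div hL hM' (x - y)).add (tendsto_sum_cos_div hL hM' (x + y)))
    have hlim : 0 + (ρ₀ * Real.sinc (ρ₀ * Real.pi * (x - y)) +
        ρ₀ * Real.sinc (ρ₀ * Real.pi * (x + y))) =
        Real.pi⁻¹ * limitKernel ρ₀ .neumann x y := by
      simp only [limitKernel, Boundary.sign]
      field_simp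
      ring
    rw [hlim] at h
    refine h.congr' ?_
    filter_upwards [(tendsto_fst_thermodynamicLimit ρ₀).eventually_ge_atTop 1] with p hp
    rw [← modeKernel_neumann_succ_eq]
    congr 1
    omega

theorem measurable_limitKernel (ρ₀ : ℝ) (ε : Boundary) :
    Measurable (Function.uncurry (limitKernel ρ₀ ε)) := by
  refine Continuous.measurable ?_
  simp only [Function.uncurry_def, limitKernel]
  have h1 : Continuous fun p : ℝ × ℝ => Real.sinc (ρ₀ * Real.pi * (p.1 - p.2)) :=
    Real.continuous_sinc.comp (by fun_prop)
  have h2 : Continuous fun p : ℝ × ℝ => Real.sinc (ρ₀ * Real.pi * (p.1 + p.2)) :=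
    Real.continuous_sinc.comp (by fun_prop)
  exact (continuous_const.mul h1).add (continuous_const.mul (continuous_const.mul h2))

theorem abs_limitKernel_le {ρ₀ : ℝ} (hρ₀ : 0 < ρ₀) (ε : Boundary) (x y : ℝ) :
    |Real.pi⁻¹ * limitKernel ρ₀ ε x y| ≤ 2 * ρ₀ := by
  have h : Real.pi⁻¹ * limitKernel ρ₀ ε x y = ρ₀ * (Real.sinc (ρ₀ * Real.pi * (x - y)) +
      ε.sign * Real.sinc (ρ₀ * Real.pi * (x + y))) := by
    have := Real.pi_ne_zero
    simp only [limitKernel]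
    field_simp
  have hs : |ε.sign| = 1 := by cases ε <;> simp [Boundary.sign]
  rw [h, abs_mul, abs_of_pos hρ₀, mul_comm 2]
  refine mul_le_mul_of_nonneg_left ?_ hρ₀.le
  refine (abs_add_le _ _).trans ?_
  rw [abs_mul, hs, one_mul]
  linarith [Real.abs_sinc_le_one (ρ₀ * Real.pi * (x - y)),
    Real.abs_sinc_le_one (ρ₀ * Real.pi * (x + y))]

theorem kernelDet_const_mul (c : ℝ) (K : ℝ → ℝ → ℝ) {n l : ℕ} (x' x'' : Fin n → ℝ)
    (z : Fin l → ℝ) :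
    kernelDet (fun x y => c * K x y) x' x'' z = c ^ (n + l) * kernelDet K x' x'' z := by
  have h := Matrix.det_smul
    (Matrix.of fun i j : Fin (n + l) => K (Fin.append x' z i) (Fin.append x'' z j)) c
  rw [Fintype.card_fin] at h
  exact h

end KernelLimit

/-! ### Summability of the Hadamard bounds -/

section Summability

theorem summable_pow_mul_sqrt_factorial {D : ℝ} (hD : 0 < D) (n : ℕ) :
    Summable fun l : ℕ => D ^ l * Real.sqrt ((n + l).factorial) / l.factorial := by
  refine summable_of_ratio_test_tendsto_lt_one (l := 0) zero_lt_one
    (Eventually.of_forall fun l => by positivity) ?_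
  have hratio : ∀ l : ℕ, ‖D ^ (l + 1) * Real.sqrt ((n + (l + 1)).factorial) / (l + 1).factorial‖ /
      ‖D ^ l * Real.sqrt ((n + l).factorial) / l.factorial‖ =
      D * Real.sqrt (((n : ℝ) + 1) / (l + 1) ^ 2 + l / (l + 1) ^ 2) := by
    intro l
    have h1 : 0 < Real.sqrt ((n + l).factorial) := Real.sqrt_pos.2 (by positivity)
    have h2 : (l.factorial : ℝ) ≠ 0 := by positivity
    have h3 : ((l : ℝ) + 1) ≠ 0 := by positivity
    rw [Real.norm_of_nonneg (by positivity), Real.norm_of_nonneg (by positivity), ← add_div,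
      Real.sqrt_div' _ (by positivity), Real.sqrt_sq (by positivity), ← add_assoc,
      Nat.factorial_succ, Nat.factorial_succ]
    push_cast
    rw [Real.sqrt_mul (by positivity), pow_succ, show (n : ℝ) + l + 1 = n + 1 + l by ring]
    field_simp
  simp only [hratio]
  have hinv : Tendsto (fun l : ℕ => 1 / ((l : ℝ) + 1)) atTop (𝓝 0) :=
    tendsto_one_div_add_atTop_nhds_zero_nat
  have hlim : Tendsto (fun l : ℕ => ((n : ℝ) + 1) / (l + 1) ^ 2 + l / (l + 1) ^ 2) atTop
      (𝓝 0) := by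
    have h := ((hinv.mul hinv).const_mul (n : ℝ)).add hinv
    simp only [mul_zero, add_zero] at h
    refine h.congr fun l => ?_
    have h3 : ((l : ℝ) + 1) ≠ 0 := by positivity
    field_simp
    ring
  have h := ((Real.continuous_sqrt.tendsto 0).comp hlim).const_mul D
  simpa using h

/-- The square root of m^m ≤ e^m m!, which follows from a single term of the exponential series. It
turns Hadamard's m^(m/2) into √(m!), which the 1/l! of the series beats. -/
theorem sqrt_pow_self_le (m : ℕ) :
    Real.sqrt m ^ m ≤ Real.sqrt (Real.exp 1) ^ m * Real.sqrt m.factorial := by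
  have h := Real.pow_div_factorial_le_exp (m : ℝ) (Nat.cast_nonneg m) m
  rw [div_le_iff₀ (by positivity)] at h
  refine (sq_le_sq₀ (by positivity) (by positivity)).1 ?_
  rw [mul_pow, ← pow_mul, ← pow_mul, mul_comm m 2, pow_mul, pow_mul, Real.sq_sqrt (by positivity),
    Real.sq_sqrt (by positivity), Real.sq_sqrt (by positivity), ← Real.exp_nat_mul, mul_one]
  exact h

theorem summable_hadamard {A C : ℝ} (hA : 0 ≤ A) (hC : 0 ≤ C) (n : ℕ) :
    Summable fun l : ℕ => A ^ l / l.factorial * (Real.sqrt (n + l) * C) ^ (n + l) := by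
  have hE : 0 < Real.sqrt (Real.exp 1) := Real.sqrt_pos.2 (Real.exp_pos 1)
  set E := Real.sqrt (Real.exp 1)
  refine Summable.of_nonneg_of_le (fun l => by positivity) (fun l => ?_)
    -- The added ones keep D positive when A or C is zero.
    ((summable_pow_mul_sqrt_factorial (D := (A + 1) * (E * C + 1)) (by positivity) n).mul_left
      ((E * C + 1) ^ n))
  have h := sqrt_pow_self_le (n + l)
  rw [Nat.cast_add] at h
  calc A ^ l / l.factorial * (Real.sqrt (n + l) * C) ^ (n + l)
      ≤ A ^ l / l.factorial * (E ^ (n + l) * Real.sqrt (n + l).factorial * C ^ (n + l)) := by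
        rw [mul_pow]; gcongr
    _ = A ^ l * (E * C) ^ (n + l) * Real.sqrt (n + l).factorial / l.factorial := by
        rw [mul_pow]; ring
    _ ≤ (A + 1) ^ l * (E * C + 1) ^ (n + l) * Real.sqrt (n + l).factorial / l.factorial := by
        gcongr <;> linarith
    _ = _ := by rw [mul_pow, pow_add]; ring

end Summability

/-! ### Passage to the thermodynamic limit -/

section Limit

variable {n : ℕ} {x' x'' : Fin n → ℝ}

theorem exists_forall_mem_Icc (hx' : ∀ j, 0 ≤ x' j) (hx'' : ∀ j, 0 ≤ x'' j) :
    ∃ L₀ : ℝ, ∀ L, L₀ ≤ L → (∀ k, x' k ∈ Set.Icc 0 L) ∧ ∀ k, x'' k ∈ Set.Icc 0 L := by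
  have h' := fun k => Finset.single_le_sum (fun j _ => hx' j) (Finset.mem_univ k)
  have h'' := fun k => Finset.single_le_sum (fun j _ => hx'' j) (Finset.mem_univ k)
  have s' : 0 ≤ ∑ j, x' j := Finset.sum_nonneg fun j _ => hx' j
  have s'' : 0 ≤ ∑ j, x'' j := Finset.sum_nonneg fun j _ => hx'' j
  -- The sum of all points dominates each of them and also makes sense for n = 0.
  refine ⟨∑ j, x' j + ∑ j, x'' j, fun L hL => ⟨fun k => ⟨hx' k, ?_⟩, fun k => ⟨hx'' k, ?_⟩⟩⟩
  · linarith [h' k]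
  · linarith [h'' k]

theorem volume_intervalUnion_lt_top (hx' : ∀ j, 0 ≤ x' j) (hx'' : ∀ j, 0 ≤ x'' j) :
    volume (intervalUnion x' x'') < ⊤ := by
  obtain ⟨L₀, h⟩ := exists_forall_mem_Icc hx' hx''
  obtain ⟨h', h''⟩ := h L₀ le_rfl
  exact (measure_mono (intervalUnion_subset h' h'')).trans_lt (by simp)

theorem volume_pi_intervalUnion_lt_top (hx' : ∀ j, 0 ≤ x' j) (hx'' : ∀ j, 0 ≤ x'' j) (l : ℕ) :
    volume (Set.univ.pi fun _ : Fin l => intervalUnion x' x'') < ⊤ := by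
  rw [volume_pi_pi]
  exact ENNReal.prod_lt_top fun _ _ => volume_intervalUnion_lt_top hx' hx''

theorem integrableOn_kernelDet {K : ℝ → ℝ → ℝ} {C : ℝ} (hK : Measurable (Function.uncurry K))
    (hC : ∀ x y, |K x y| ≤ C) (hx' : ∀ j, 0 ≤ x' j) (hx'' : ∀ j, 0 ≤ x'' j) (l : ℕ) :
    IntegrableOn (fun z : Fin l → ℝ => kernelDet K x' x'' z)
      (Set.univ.pi fun _ => intervalUnion x' x'') :=
  IntegrableOn.of_bound (volume_pi_intervalUnion_lt_top hx' hx'' l)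
    (measurable_kernelDet hK x' x'').aestronglyMeasurable _
    (ae_of_all _ fun _ => abs_kernelDet_le (S := Set.univ) ((abs_nonneg _).trans (hC 0 0))
      (fun x _ y _ => hC x y) (fun _ => trivial) (fun _ => trivial) fun _ => trivial)

theorem abs_integral_kernelDet_le {K : ℝ → ℝ → ℝ} {C : ℝ}
    (hC : ∀ x y, |K x y| ≤ C) (hx' : ∀ j, 0 ≤ x' j) (hx'' : ∀ j, 0 ≤ x'' j) (l : ℕ) :
    |(-2) ^ l / (l.factorial : ℝ) * ∫ z in Set.univ.pi fun _ : Fin l => intervalUnion x' x'',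
      kernelDet K x' x'' z| ≤ (2 * volume.real (intervalUnion x' x'')) ^ l / l.factorial *
        (Real.sqrt (n + l) * C) ^ (n + l) := by
  have hC0 : 0 ≤ C := (abs_nonneg _).trans (hC 0 0)
  have h := norm_setIntegral_le_of_norm_le_const
    (f := fun z : Fin l → ℝ => kernelDet K x' x'' z)
    (volume_pi_intervalUnion_lt_top hx' hx'' l)
    (fun z _ => abs_kernelDet_le (S := Set.univ) hC0 (fun x _ y _ => hC x y)
      (fun _ => trivial) (fun _ => trivial) fun _ => trivial)
  have hvol : volume.real (Set.univ.pi fun _ : Fin l => intervalUnion x' x'') =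
      volume.real (intervalUnion x' x'') ^ l := by
    simp [measureReal_def, volume_pi_pi]
  rw [hvol, Real.norm_eq_abs] at h
  rw [abs_mul, abs_div, abs_pow, abs_neg, abs_two, Nat.abs_cast]
  refine (mul_le_mul_of_nonneg_left h (by positivity)).trans (le_of_eq ?_)
  rw [mul_pow]
  ring

/-- Of the l + n factors -2/π, the prefactor (-1/2)^n cancels n factors -2, and the l + n factors
1/π are moved into the rows of the kernel determinant. -/
theorem fredholmMinorTerm_eq (ρ₀ : ℝ) (ε : Boundary) (x' x'' : Fin n → ℝ) (l : ℕ) :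
    (-1 / 2) ^ n * fredholmMinorTerm (limitKernel ρ₀ ε) (intervalUnion x' x'') (2 / Real.pi)
      x' x'' l = (-2) ^ l / (l.factorial : ℝ) *
        ∫ z in Set.univ.pi fun _ : Fin l => intervalUnion x' x'',
          kernelDet (fun x y => Real.pi⁻¹ * limitKernel ρ₀ ε x y) x' x'' z := by
  simp only [kernelDet_const_mul, fredholmMinorTerm, integral_const_mul]
  have h : (-1 / 2 : ℝ) ^ n * (-(2 / Real.pi)) ^ (l + n) = (-2) ^ l * Real.pi⁻¹ ^ (n + l) := by
    have h1 : (-(2 / Real.pi) : ℝ) = -2 * Real.pi⁻¹ := by ring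
    have h2 : (-1 / 2 : ℝ) ^ n * (-2) ^ n = 1 := by rw [← mul_pow]; norm_num
    rw [h1, mul_pow, pow_add, add_comm l n]
    linear_combination (-2) ^ l * Real.pi⁻¹ ^ (n + l) * h2
  linear_combination (∫ z in Set.univ.pi fun _ : Fin l => intervalUnion x' x'',
    kernelDet (limitKernel ρ₀ ε) x' x'' z) / (l.factorial : ℝ) * h

theorem summable_fredholmMinorTerm {ρ₀ : ℝ} (hρ₀ : 0 < ρ₀) (ε : Boundary)
    (hx' : ∀ j, 0 ≤ x' j) (hx'' : ∀ j, 0 ≤ x'' j) :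
    Summable fun l : ℕ => fredholmMinorTerm (limitKernel ρ₀ ε) (intervalUnion x' x'')
      (2 / Real.pi) x' x'' l := by
  have h : Summable fun l : ℕ => (-1 / 2) ^ n * fredholmMinorTerm (limitKernel ρ₀ ε)
      (intervalUnion x' x'') (2 / Real.pi) x' x'' l := by
    refine Summable.of_norm_bounded (summable_hadamard
      (A := 2 * volume.real (intervalUnion x' x'')) (C := 2 * ρ₀) (by positivity) (by positivity)
      n) fun l => ?_
    rw [fredholmMinorTerm_eq]
    exact abs_integral_kernelDet_le (abs_limitKernel_le hρ₀ ε) hx' hx'' l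
  exact (summable_mul_left_iff (by norm_num)).1 h

/-- For L ≥ 1 one has (n + N)/L ≤ n + ρ₀, which gives a bound independent of N and L. -/
theorem eventually_abs_modeKernel_le (ρ₀ : ℝ) (ε : Boundary) (n : ℕ) :
    ∀ᶠ p : ℕ × ℝ in thermodynamicLimit ρ₀, ∀ x y,
      |modeKernel ε p.2 (n + p.1) x y| ≤ 2 * (n + ρ₀) := by
  filter_upwards [(tendsto_snd_thermodynamicLimit ρ₀).eventually_ge_atTop 1,
    eventually_density_eq ρ₀] with p hp hρ x y
  refine (abs_modeKernel_le (by linarith) ε _ x y).trans ?_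
  rw [Nat.cast_add, add_div, hρ]
  gcongr
  exact div_le_self (Nat.cast_nonneg n) hp

theorem tendsto_integral_kernelDet_modeKernel (ρ₀ : ℝ) (ε : Boundary)
    (hx' : ∀ j, 0 ≤ x' j) (hx'' : ∀ j, 0 ≤ x'' j) (l : ℕ) :
    Tendsto (fun p : ℕ × ℝ => ∫ z in Set.univ.pi fun _ : Fin l => intervalUnion x' x'',
        kernelDet (modeKernel ε p.2 (n + p.1)) x' x'' z) (thermodynamicLimit ρ₀)
      (𝓝 (∫ z in Set.univ.pi fun _ : Fin l => intervalUnion x' x'',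
        kernelDet (fun x y => Real.pi⁻¹ * limitKernel ρ₀ ε x y) x' x'' z)) := by
  refine tendsto_integral_filter_of_dominated_convergence
    (fun _ => (Real.sqrt (n + l) * (2 * (n + ρ₀))) ^ (n + l))
    (Eventually.of_forall fun p =>
      (measurable_kernelDet (measurable_modeKernel ε _ _) x' x'').aestronglyMeasurable) ?_
    (integrableOn_const (volume_pi_intervalUnion_lt_top hx' hx'' l).ne) ?_
  · filter_upwards [eventually_abs_modeKernel_le ρ₀ ε n] with p hp
    exact ae_of_all _ fun z => abs_kernelDet_le (S := Set.univ)
      ((abs_nonneg _).trans (hp 0 0)) (fun x _ y _ => hp x y) (fun _ => trivial)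
      (fun _ => trivial) fun _ => trivial
  · refine ae_of_all _ fun z => ?_
    simp only [kernelDet, Matrix.det_apply, Matrix.of_apply]
    exact tendsto_finsetSum _ fun σ _ =>
      (tendsto_finsetProd _ fun i _ => tendsto_modeKernel ρ₀ ε n _ _).const_smul _

theorem tendsto_correlation {ρ₀ : ℝ} (hρ₀ : 0 < ρ₀) (ε : Boundary) (hx' : ∀ j, 0 ≤ x' j)
    (hx'' : ∀ j, 0 ≤ x'' j) :
    Tendsto (fun p : ℕ × ℝ => correlation n p.1 p.2 ε x' x'') (thermodynamicLimit ρ₀)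
      (𝓝 ((-1 / 2) ^ n * signFactor x' x'' * fredholmMinor (limitKernel ρ₀ ε)
        (intervalUnion x' x'') (2 / Real.pi) x' x'')) := by
  -- Extending the finite sum over l ≤ N by zero to a series lets one summable majorant serve all N
  -- and L; a fixed l lies below the cutoff once N ≥ l.
  set T : ℕ × ℝ → ℕ → ℝ := fun p l => if l < p.1 + 1 then
    (-2) ^ l / (l.factorial : ℝ) * ∫ z in Set.univ.pi fun _ : Fin l => intervalUnion x' x'',
      kernelDet (modeKernel ε p.2 (n + p.1)) x' x'' z else 0 with hT
  have hlim : Tendsto (fun p => ∑' l, T p l) (thermodynamicLimit ρ₀)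
      (𝓝 (∑' l, (-1 / 2) ^ n * fredholmMinorTerm (limitKernel ρ₀ ε) (intervalUnion x' x'')
        (2 / Real.pi) x' x'' l)) := by
    refine tendsto_tsum_of_dominated_convergence (summable_hadamard
      (A := 2 * volume.real (intervalUnion x' x'')) (C := 2 * (n + ρ₀)) (by positivity)
      (by positivity) n) (fun l => ?_) ?_
    · rw [fredholmMinorTerm_eq]
      refine ((tendsto_integral_kernelDet_modeKernel ρ₀ ε hx' hx'' l).const_mul _).congr' ?_
      filter_upwards [(tendsto_fst_thermodynamicLimit ρ₀).eventually_ge_atTop l] with p hp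
      rw [hT]
      exact (if_pos (Nat.lt_succ_of_le hp)).symm
    · filter_upwards [eventually_abs_modeKernel_le ρ₀ ε n] with p hp l
      simp only [hT]
      split_ifs
      · exact abs_integral_kernelDet_le hp hx' hx'' l
      · rw [norm_zero]
        positivity
  rw [tsum_mul_left] at hlim
  have hlim' := hlim.const_mul (signFactor x' x'')
  rw [← mul_assoc, mul_comm (signFactor x' x'')] at hlim'
  refine hlim'.congr' ?_
  obtain ⟨L₀, hL₀⟩ := exists_forall_mem_Icc hx' hx''
  filter_upwards [(tendsto_snd_thermodynamicLimit ρ₀).eventually_ge_atTop L₀,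
    (tendsto_snd_thermodynamicLimit ρ₀).eventually_gt_atTop 0] with p hp hp0
  rw [correlation_eq_sum hp0 ε p.1 (hL₀ _ hp).1 (hL₀ _ hp).2,
    tsum_eq_sum (s := Finset.range (p.1 + 1)) fun l hl => by
      simp only [hT]; exact if_neg (by simpa using hl)]
  congr 1
  exact Finset.sum_congr rfl fun l hl => if_pos (Finset.mem_range.1 hl)

end Limit

end BoseGas

theorem mainTheorem2 (ρ₀ : ℝ) (hρ₀ : 0 < ρ₀) (ε : BoseGas.Boundary) (n : ℕ)
    (x' x'' : Fin n → ℝ) (hx' : ∀ j, 0 ≤ x' j) (hx'' : ∀ j, 0 ≤ x'' j) :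
    (∀ l : ℕ, MeasureTheory.IntegrableOn
      (fun z : Fin l → ℝ => BoseGas.kernelDet (BoseGas.limitKernel ρ₀ ε) x' x'' z)
      (Set.univ.pi fun _ => BoseGas.intervalUnion x' x'')) ∧
    Summable (fun l : ℕ => BoseGas.fredholmMinorTerm (BoseGas.limitKernel ρ₀ ε)
      (BoseGas.intervalUnion x' x'') (2 / Real.pi) x' x'' l) ∧
    Filter.Tendsto (fun p : ℕ × ℝ => BoseGas.correlation n p.1 p.2 ε x' x'')
      (BoseGas.thermodynamicLimit ρ₀)
      (nhds ((-1 / 2) ^ n * BoseGas.signFactor x' x'' *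
        BoseGas.fredholmMinor (BoseGas.limitKernel ρ₀ ε)
          (BoseGas.intervalUnion x' x'') (2 / Real.pi) x' x'')) := by
  refine ⟨fun l => BoseGas.integrableOn_kernelDet (C := Real.pi * (2 * ρ₀))
    (BoseGas.measurable_limitKernel ρ₀ ε) (fun x y => ?_) hx' hx'' l,
    BoseGas.summable_fredholmMinorTerm hρ₀ ε hx' hx'',
    BoseGas.tendsto_correlation hρ₀ ε hx' hx''⟩
  have h := BoseGas.abs_limitKernel_le hρ₀ ε x y
  rw [abs_mul, abs_of_pos (inv_pos.2 Real.pi_pos)] at h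
  rwa [inv_mul_le_iff₀ Real.pi_pos] at h
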